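/- Let $K$ be a field and let $A=K[x_1,\dots,x_n]/Q$ be a standard graded $K$-algebra ($\deg x_i=1$, $Q$ a homogeneous ideal). Let $M$ be a finitely generated $\mathbb Z$-graded $A$-module generated in a single degree $e$. Its symmetric algebra $S(M)=\bigoplus_{j\ge 0}S^j(M)$ over $A$ is bigraded by letting $S(M)_{(i,j)}$ be the $K$-span of the products $r f_1\cdots f_j$ with $r\in A_i$ and $f_1,\dots,f_j\in M_e$; it is regarded as a standard graded $K$-algebra through the total degree, $S(M)_k=\bigoplus_{i+j=k}S(M)_{(i,j)}$. A graded module $N$ over a standard graded $K$-algebra $B$ is said to have an $a$-linear resolution if there is an exact complex of graded $B$-modules, with maps homogeneous of degree $0$, $$\cdots\to B(-a-2)^{b_2}\to B(-a-1)^{b_1}\to B(-a)^{b_0}\to N\to 0\qquad (b_i\in\mathbb N),$$ and $B$ is Koszul if the residue class field $B/\bigoplus_{i>0}B_i$, in degree $0$, has a $0$-linear resolution over $B$. (By this definition the zero module has an $a$-linear resolution for every $a$.) If $S(M)$ is Koszul, then $A$ is Koszul and, for every $j\ge 0$, the graded $A$-module $S^j(M)$ has a $je$-linear resolution, where $S^j(M)$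 carries its natural grading in which $m_1\cdots m_j$ has degree $\deg m_1+\dots+\deg m_j$ for homogeneous $m_1,\dots,m_j\in M$. -/

import Mathlib

namespace KoszulSym

universe u v w

section General

variable {K : Type u} [Field K] {A : Type v} [CommRing A] [Algebra K A]

/-- A standard graded `K`-algebra: `A₀ = K · 1`, `A₁` is finite dimensional, and `A` is generated
by `A₁`. Equivalently `A = K[x₁, …, xₙ] / Q` with `deg xᵢ = 1` and `Q` a homogeneous ideal. -/
structure IsStandardGraded (𝒜 : ℕ → Submodule K A) [GradedAlgebra 𝒜] : Prop where
  degree_zero : 𝒜 0 = 1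
  finite_one : FiniteDimensional K (𝒜 1)
  generated : Algebra.adjoin K (𝒜 1 : Set A) = ⊤

variable {M : Type w} [AddCommGroup M] [Module K M] [Module A M]

/-- `M = ⨁ₖ ℳ k` is a `ℤ`-graded module over `A = ⨁ᵢ 𝒜 i`. -/
structure IsGradedModule (𝒜 : ℕ → Submodule K A) (ℳ : ℤ → Submodule K M) : Prop where
  isInternal : DirectSum.IsInternal ℳ
  smul_mem : ∀ (i : ℕ) (k : ℤ) (r : A) (x : M), r ∈ 𝒜 i → x ∈ ℳ k → r • x ∈ ℳ (i + k)

/-- An `a`-linear graded free resolution of the graded `A`-module `M`, that is, an exact complex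
`⋯ → A(-a-2)^{b₂} → A(-a-1)^{b₁} → A(-a)^{b₀} → M → 0`
of finite free graded modules and homogeneous maps of degree zero. The standard basis vectors of
`A(-a-i)^{bᵢ}` have degree `a + i`, so the maps of degree zero from the `(i+1)`-st to the `i`-th
module are those whose matrix entries lie in `A₁`, and those from the `0`-th module to `M` are
the ones sending each basis vector into `M_a`. -/
structure LinearResolution (𝒜 : ℕ → Submodule K A) (ℳ : ℤ → Submodule K M) (a : ℤ) where
  rank : ℕ → ℕ
  d : ∀ i : ℕ, (Fin (rank (i + 1)) → A) →ₗ[A] (Fin (rank i) → A)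
  aug : (Fin (rank 0) → A) →ₗ[A] M
  d_entry_mem : ∀ (i : ℕ) (k : Fin (rank (i + 1))) (l : Fin (rank i)),
    d i (Pi.single k 1) l ∈ 𝒜 1
  aug_mem : ∀ k : Fin (rank 0), aug (Pi.single k 1) ∈ ℳ a
  aug_surjective : Function.Surjective aug
  exact_zero : Function.Exact (d 0) aug
  exact_succ : ∀ i : ℕ, Function.Exact (d (i + 1)) (d i)

/-- The graded `A`-module `M` has an `a`-linear resolution. -/
def HasLinearResolution (𝒜 : ℕ → Submodule K A) (ℳ : ℤ → Submodule K M) (a : ℤ) : Prop :=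
  Nonempty (LinearResolution 𝒜 ℳ a)

/-- The ideal generated by all homogeneous elements of positive degree. -/
def irrelevantIdeal (𝒜 : ℕ → Submodule K A) : Ideal A :=
  Ideal.span {x : A | ∃ i : ℕ, 0 < i ∧ x ∈ 𝒜 i}

/-- The grading of the residue class field `A / 𝔪`, which is concentrated in degree zero. -/
def residueGrading (𝒜 : ℕ → Submodule K A) : ℤ → Submodule K (A ⧸ irrelevantIdeal 𝒜) :=
  fun k => if k = 0 then ⊤ else ⊥

/-- `A` is Koszul: the residue class field `K = A / 𝔪`, as a graded module concentrated in degree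
zero, has a linear free resolution over `A`. -/
def IsKoszul (𝒜 : ℕ → Submodule K A) : Prop :=
  HasLinearResolution 𝒜 (residueGrading 𝒜) 0

end General

section Symmetric

variable {K : Type u} [Field K] {A : Type v} [CommRing A] [Algebra K A]
  {M : Type w} [AddCommGroup M] [Module K M] [Module A M] [IsScalarTower K A M]

/-- The component of bidegree `(i, j)` of `S(M)`, for `M` generated in degree `e`: it is spanned
over `K` by the products `r · f₁ ⋯ f_j` with `r ∈ A_i` and `f₁, …, f_j ∈ M_e`. So the elements of
`A₁` have bidegree `(1, 0)` and the generators of `M` have bidegree `(0, 1)`. -/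
def symBigrading (𝒜 : ℕ → Submodule K A) (ℳ : ℤ → Submodule K M) (e : ℤ) (i j : ℕ) :
    Submodule K (SymmetricAlgebra A M) :=
  Submodule.span K {s | ∃ (r : A) (f : Fin j → M), r ∈ 𝒜 i ∧ (∀ l, f l ∈ ℳ e) ∧
    s = algebraMap A (SymmetricAlgebra A M) r * ∏ l, SymmetricAlgebra.ι A M (f l)}

/-- The `ℕ`-grading of `S(M)` by total degree, `S(M)_k = ⨁_{i + j = k} S(M)_{(i, j)}`. -/
def symTotalGrading (𝒜 : ℕ → Submodule K A) (ℳ : ℤ → Submodule K M) (e : ℤ) :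
    ℕ → Submodule K (SymmetricAlgebra A M) :=
  fun k => ⨆ (i : ℕ) (j : ℕ) (_ : i + j = k), symBigrading 𝒜 ℳ e i j

variable (A M) in
/-- The symmetric power `S^j(M)`: the `A`-submodule of `S(M)` spanned by the products of `j`
elements of `M`. -/
abbrev symPower (j : ℕ) : Submodule A (SymmetricAlgebra A M) :=
  LinearMap.range (SymmetricAlgebra.ι A M) ^ j

/-- The natural grading of the `A`-module `S^j(M)`: for homogeneous `r ∈ A` and
`m₁, …, m_j ∈ M`, the element `r · m₁ ⋯ m_j` has degree `deg r + deg m₁ + ⋯ + deg m_j`. -/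
def symPowerGrading (𝒜 : ℕ → Submodule K A) (ℳ : ℤ → Submodule K M) (j : ℕ) :
    ℤ → Submodule K (symPower A M j) :=
  fun k => Submodule.span K {s | ∃ (i : ℕ) (r : A) (n : Fin j → ℤ) (m : Fin j → M),
    r ∈ 𝒜 i ∧ (∀ l, m l ∈ ℳ (n l)) ∧ (i : ℤ) + ∑ l, n l = k ∧
    (s : SymmetricAlgebra A M) =
      algebraMap A (SymmetricAlgebra A M) r * ∏ l, SymmetricAlgebra.ι A M (m l)}

end Symmetric

end KoszulSym

/-! Write S for the symmetric algebra with its bigrading. Then A is the part S_(*,0), the module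
S^j(M) is S_(*,j) up to a shift, and killing positive second degree gives a retraction π : S → A.
Let F be a minimal bigraded linear resolution of K over S. A basis element of F_n has bidegree (n -
b, b) for some b ≥ 0. Those with b = 0 span a subcomplex whose matrices have entries in A_1; let L
be the corresponding complex over A. The reduction F' = A ⊗_S F splits over A according to b, and L
is its part b = 0.

The central claim is `BigradedComplex.kos_strandD`: for every j, S_(*,j) ⊗_A L is exact in positive
first degree. For j = 0 this says that L resolves the residue field of A; for general j it then says
that Tor^A(S^j(M), K) is concentrated on the linear strand. The proof is by strong induction on j. A
cycle x of positive first degree is a cycle of F, hence has a bihomogeneous primitive there, with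
components at 0 ≤ b ≤ j. Its component at the largest b = c > 0 is a cycle of S_(*,j-c) ⊗_A F' in
positive first degree. If that complex is exact there, a boundary of F can be subtracted to remove
the component (`exists_eliminate`). In the end only b = 0 survives, and x is a boundary in the
strand.

The induction hypothesis concerns L, while the elimination needs F'; `kos_baseD` bridges the gap. As
F is acyclic over S, the identity of F extends to a chain map (S ⊗_A L) ⊗_S F → F of degree zero
(`exists_comparison`). Applying π gives L ⊗_A F' → F', although F' itself need not be acyclic. A
zigzag in the double complex then transfers exactness from L to F' (`Kos.transfer`).

Linear resolutions and the exactness condition `Kos` are interchangeable: `Kos` passes to syzygies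
(`Kos.ker`), so minimal generators may be chosen repeatedly, homogeneous for any second compatible
grading. This produces F from an arbitrary linear resolution over S, and linear resolutions over A
from L. -/

namespace KoszulSym

open Finset

/-! ### Gradings given by their projections -/

section Grading

/-- A grading of the commutative algebra `B` by the group `ι`, given by its projections. -/
structure GradingProj (ι K B : Type*) [AddCommGroup ι] [Field K] [CommRing B] [Algebra K B] where
  proj : ι → B →ₗ[K] B
  proj_self : ∀ k x, proj k (proj k x) = proj k x
  proj_ne : ∀ k l x, k ≠ l → proj k (proj l x) = 0
  exists_sum : ∀ x, ∃ s : Finset ι, ∑ k ∈ s, proj k x = x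
  proj_mul : ∀ k l x y, proj l y = y → proj k (x * y) = proj (k - l) x * y
  proj_one : proj 0 1 = 1

namespace GradingProj

variable {ι K B : Type*} [AddCommGroup ι] [Field K] [CommRing B] [Algebra K B]
  (G : GradingProj ι K B)

/-- The homogeneous component of degree `k`. -/
def deg (k : ι) : Submodule K B where
  carrier := {x | G.proj k x = x}
  add_mem' := fun {a b} ha hb => by
    simp only [Set.mem_ofPred_eq] at *
    rw [map_add, ha, hb]
  zero_mem' := map_zero _
  smul_mem' := fun c x hx => by
    simp only [Set.mem_ofPred_eq] at *
    rw [map_smul, hx]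

variable {G}

theorem mem_deg {k : ι} {x : B} : x ∈ G.deg k ↔ G.proj k x = x := Iff.rfl

theorem proj_mem (k : ι) (x : B) : G.proj k x ∈ G.deg k := G.proj_self k x

theorem proj_of_mem_ne {k l : ι} {x : B} (hx : x ∈ G.deg l) (h : k ≠ l) : G.proj k x = 0 := by
  rw [← mem_deg.1 hx, G.proj_ne k l x h]

theorem proj_mul_of_mem {k l : ι} {x y : B} (hy : y ∈ G.deg l) :
    G.proj k (x * y) = G.proj (k - l) x * y := G.proj_mul k l x y hy

theorem mul_mem {k l : ι} {x y : B} (hx : x ∈ G.deg k) (hy : y ∈ G.deg l) :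
    x * y ∈ G.deg (k + l) := by
  rw [mem_deg, proj_mul_of_mem hy, add_sub_cancel_right, mem_deg.1 hx]

theorem one_mem : (1 : B) ∈ G.deg 0 := G.proj_one

theorem algebraMap_mem (c : K) : algebraMap K B c ∈ G.deg 0 := by
  rw [Algebra.algebraMap_eq_smul_one]
  exact Submodule.smul_mem _ _ one_mem

/-- Finitely many elements have a common finite set of degrees, up to given shifts. -/
theorem exists_sum_pi {ν : Type*} [Finite ν] (β : ν → ι) (x : ν → B) :
    ∃ s : Finset ι, ∑ k ∈ s, (fun e => G.proj (k - β e) (x e)) = x := by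
  classical
  cases nonempty_fintype ν
  choose s hs using fun e => G.exists_sum (x e)
  refine ⟨Finset.univ.biUnion fun e => (s e).map (addRightEmbedding (β e)), ?_⟩
  funext e
  rw [Finset.sum_apply]
  rw [← Finset.sum_subset (Finset.subset_biUnion_of_mem
    (fun e => (s e).map (addRightEmbedding (β e))) (Finset.mem_univ e))]
  · simp only [Finset.sum_map, addRightEmbedding_apply, add_sub_cancel_right]
    exact hs e
  intro k _ hk
  conv_lhs => rw [← hs e]
  rw [map_sum]
  refine Finset.sum_eq_zero fun l hl => G.proj_ne _ _ _ ?_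
  rintro rfl
  exact hk (Finset.mem_map.2 ⟨_, hl, by simp⟩)

/-- The trivial grading. -/
def trivial (K B : Type*) [Field K] [CommRing B] [Algebra K B] : GradingProj PUnit.{1} K B where
  proj _ := LinearMap.id
  proj_self _ _ := rfl
  proj_ne _ _ _ h := (h rfl).elim
  exists_sum x := ⟨{0}, by simp⟩
  proj_mul _ _ _ _ _ := rfl
  proj_one := rfl

end GradingProj

/-- A nonnegative grading whose component of degree zero consists of the constants. -/
structure GradingProj.IsConnected {K B : Type*} [Field K] [CommRing B] [Algebra K B]
    (T : GradingProj ℤ K B) : Prop where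
  proj_neg : ∀ k < 0, ∀ x, T.proj k x = 0
  proj_zero : ∀ x, ∃ c : K, T.proj 0 x = algebraMap K B c

end Grading

/-! ### Matrices over a ring acting on tuples from a module -/

section Act

variable {B N N' : Type*} [CommRing B] [AddCommGroup N] [Module B N] [AddCommGroup N'] [Module B N']
  {l m n : Type*} [Fintype l] [Fintype m]

/-- The map `N ^ m → N ^ n` given by a matrix over `B`. -/
def act (D : m → n → B) : (m → N) →ₗ[B] (n → N) where
  toFun y j := ∑ k, D k j • y k
  map_add' x y := by
    funext j
    simp [Finset.sum_add_distrib]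
  map_smul' c x := by
    funext j
    simp [Finset.smul_sum, smul_comm c]

theorem act_apply (D : m → n → B) (y : m → N) (j : n) : act D y j = ∑ k, D k j • y k := rfl

theorem act_act (D : l → m → B) (D' : m → n → B) (y : l → N) :
    act D' (act D y) = act (fun i k => ∑ j, D i j * D' j k) y := by
  funext k
  simp only [act_apply, Finset.smul_sum, Finset.sum_smul]
  rw [Finset.sum_comm]
  refine Finset.sum_congr rfl fun i _ => Finset.sum_congr rfl fun j _ => ?_
  rw [smul_smul, mul_comm]

theorem map_act (φ : N →ₗ[B] N') (D : m → n → B) (y : m → N) :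
    (fun j => φ (act D y j)) = act D (fun k => φ (y k)) := by
  funext j
  simp [act_apply]

theorem act_zero_matrix (y : m → N) : act (fun _ _ => 0 : m → n → B) y = 0 := by
  funext j
  simp [act_apply]

end Act

/-! ### Exactness in positive degrees as a criterion for linearity -/

section Kos

variable {K B : Type*} [Field K] [CommRing B] [Algebra K B]
  {N : Type*} [AddCommGroup N] [Module B N]

/-- Cycles of the complex `N ⊗ F`, with every element of `N ⊗ F₀` being a cycle. -/
def IsCyc {E : ℕ → Type} [∀ n, Fintype (E n)] (D : ∀ n, E (n + 1) → E n → B) :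
    ∀ n, (E n → N) → Prop
  | 0, _ => True
  | n + 1, x => act (D n) x = 0

/-- The complex `N ⊗ F` is exact in positive degrees of `N`. -/
def Kos [Module K N] {E : ℕ → Type} [∀ n, Fintype (E n)] (D : ∀ n, E (n + 1) → E n → B)
    (𝒩 : ℕ → Submodule K N) : Prop :=
  ∀ (n i : ℕ) (x : E n → N), (∀ k, x k ∈ 𝒩 (i + 1)) → IsCyc D n x →
    ∃ y : E (n + 1) → N, (∀ k, y k ∈ 𝒩 i) ∧ act (D n) y = x

/-- A linear complex of finite free modules, with `F₀ ≠ 0`, which is exact in positive internal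
degree. -/
structure KoszulComplex (T : GradingProj ℤ K B) where
  E : ℕ → Type
  fin : ∀ n, Fintype (E n)
  D : ∀ n, E (n + 1) → E n → B
  D_mem : ∀ n k l, D n k l ∈ T.deg 1
  D_comp : ∀ n k l, ∑ j, D (n + 1) k j * D n j l = 0
  exact : Kos D (fun i : ℕ => T.deg (i : ℤ))
  nonempty : Nonempty (E 0)

attribute [instance] KoszulComplex.fin

variable {T : GradingProj ℤ K B}

theorem KoszulComplex.act_act_eq_zero (C : KoszulComplex T) (n : ℕ) (y : C.E (n + 2) → N) :
    act (C.D n) (act (C.D (n + 1)) y) = 0 := by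
  rw [act_act]
  simp only [C.D_comp]
  exact act_zero_matrix y

/-- The components of a submodule of `B ^ ν`, shifted by one. -/
def piece (T : GradingProj ℤ K B) {ν : Type} (Z : Submodule B (ν → B)) (i : ℕ) :
    Submodule K (ν → B) where
  carrier := {x | x ∈ Z ∧ ∀ e, x e ∈ T.deg ((i + 1 : ℕ) : ℤ)}
  add_mem' := fun {a b} ha hb => ⟨Z.add_mem ha.1 hb.1,
    fun e => Submodule.add_mem _ (ha.2 e) (hb.2 e)⟩
  zero_mem' := ⟨Z.zero_mem, fun _ => Submodule.zero_mem _⟩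
  smul_mem' := fun c x hx => ⟨by
    rw [← algebraMap_smul B c x]
    exact Z.smul_mem _ hx.1, fun e => Submodule.smul_mem _ _ (hx.2 e)⟩

theorem act_mem_deg {m n : Type*} [Fintype m] {k l : ℤ} {D : m → n → B}
    (hD : ∀ i j, D i j ∈ T.deg l) {y : m → B} (hy : ∀ i, y i ∈ T.deg k) (j : n) :
    ∑ i, D i j * y i ∈ T.deg (k + l) := by
  refine Submodule.sum_mem _ fun i _ => ?_
  rw [mul_comm]
  exact GradingProj.mul_mem (hy i) (hD i j)

variable [Module K N]

/-- The kernel of a graded cover inherits exactness in positive degrees. -/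
theorem Kos.ker (C : KoszulComplex T) {𝒩 : ℕ → Submodule K N} (hN : Kos C.D 𝒩) {ν : Type}
    (φ : (ν → B) →ₗ[B] N) (h1 : ∀ (i : ℕ) x, (∀ e, x e ∈ T.deg (i : ℤ)) → φ x ∈ 𝒩 i)
    (h2 : ∀ (i : ℕ), ∀ y ∈ 𝒩 i, ∃ x, (∀ e, x e ∈ T.deg (i : ℤ)) ∧ φ x = y) :
    Kos C.D (piece T (LinearMap.ker φ)) := by
  intro n i z hz hc
  -- Each coordinate of z is a cycle over B itself, of degree i + 2 because `piece` is shifted by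
  -- one, hence a boundary there. The primitive y need not lie in the kernel of φ.
  have h (e : ν) : ∃ y : C.E (n + 1) → B, (∀ k, y k ∈ T.deg ((i + 1 : ℕ) : ℤ)) ∧
      act (C.D n) y = fun k => z k e := by
    refine C.exact n (i + 1) (fun k => z k e) (fun k => (hz k).2 e) ?_
    cases n with
    | zero => exact True.intro
    | succ n =>
      funext l
      have := congrFun (congrFun hc l) e
      rw [act_apply, Finset.sum_apply] at this
      exact this
  choose y hy hyz using h
  have hyz' : act (C.D n) (fun k e => y e k) = z := by
    funext l e
    rw [act_apply, Finset.sum_apply]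
    exact congrFun (hyz e) l
  -- The defect φ(y) is a cycle over N, of degree i + 1 > 0, hence the boundary of some u.
  -- Subtracting the boundary of a lift of u moves y into the kernel without changing its own
  -- boundary.
  obtain ⟨u, hu, huy⟩ := hN (n + 1) i (fun k => φ fun e => y e k)
    (fun k => h1 _ _ fun e => hy e k) (by
      change act (C.D n) _ = 0
      rw [← map_act φ (C.D n), hyz']
      funext l
      exact (hz l).1)
  choose v hv hvu using fun k => h2 i (u k) (hu k)
  refine ⟨(fun k e => y e k) - act (C.D (n + 1)) v, fun k => ⟨?_, fun e => ?_⟩, ?_⟩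
  · rw [LinearMap.mem_ker, Pi.sub_apply, map_sub, sub_eq_zero, ← congrFun huy k]
    have := congrFun (map_act φ (C.D (n + 1)) v) k
    rw [this]
    simp only [hvu]
  · refine Submodule.sub_mem _ (hy e k) ?_
    rw [act_apply, Finset.sum_apply]
    push_cast
    exact act_mem_deg (C.D_mem (n + 1)) (fun l => hv l e) k
  · rw [map_sub, hyz', C.act_act_eq_zero, sub_zero]

/-- If `N ⊗ F` is exact in positive degrees, then `N` is generated in degree zero. -/
theorem Kos.exists_lift (C : KoszulComplex T) [IsScalarTower K B N] {𝒩 : ℕ → Submodule K N}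
    (hN : Kos C.D 𝒩) {ν : Type} [Fintype ν] {M : ν → N}
    (hM : 𝒩 0 ≤ Submodule.span K (Set.range M)) (i : ℕ) :
    ∀ y ∈ 𝒩 i, ∃ x : ν → B, (∀ e, x e ∈ T.deg (i : ℤ)) ∧ Fintype.linearCombination B M x = y := by
  induction i with
  | zero =>
    intro y hy
    obtain ⟨c, rfl⟩ := (Submodule.mem_span_range_iff_exists_fun K).1 (hM hy)
    refine ⟨fun e => algebraMap K B (c e), fun e => GradingProj.algebraMap_mem _, ?_⟩
    simp [Fintype.linearCombination_apply]
  | succ i ih =>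
    intro y hy
    -- Everything is a cycle in homological degree zero, so exactness there, read in a single
    -- coordinate, writes y as a combination of elements of 𝒩 i with coefficients of degree one.
    obtain ⟨e₀⟩ := C.nonempty
    obtain ⟨z, hz, hzy⟩ := hN 0 i (fun _ => y) (fun _ => hy) True.intro
    choose w hw hwz using fun k => ih (z k) (hz k)
    refine ⟨fun e => ∑ k, C.D 0 k e₀ * w k e, fun e => ?_, ?_⟩
    · push_cast
      exact act_mem_deg (C.D_mem 0) (fun l => hw l e) e₀
    · have : (fun e => ∑ k, C.D 0 k e₀ * w k e) = ∑ k, C.D 0 k e₀ • w k := by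
        funext e
        simp
      rw [this, map_sum, ← congrFun hzy e₀, act_apply]
      simp only [map_smul, hwz]

/-- Exactness at F₀ makes the piece of degree i + 1 part of the image of finitely many copies of the
piece of degree i. -/
theorem Kos.finite (C : KoszulComplex T) [IsScalarTower K B N] {𝒩 : ℕ → Submodule K N}
    (hN : Kos C.D 𝒩) (h0 : FiniteDimensional K (𝒩 0)) (i : ℕ) : FiniteDimensional K (𝒩 i) := by
  induction i with
  | zero => exact h0
  | succ i ih =>
    obtain ⟨e₀⟩ := C.nonempty
    let f : (C.E 1 → 𝒩 i) →ₗ[K] N :=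
      ∑ k, (((LinearMap.lsmul B N (C.D 0 k e₀)).restrictScalars K).comp (𝒩 i).subtype).comp
        (LinearMap.proj k)
    have hle : 𝒩 (i + 1) ≤ LinearMap.range f := by
      intro y hy
      obtain ⟨z, hz, hzy⟩ := hN 0 i (fun _ => y) (fun _ => hy) True.intro
      refine ⟨fun k => ⟨z k, hz k⟩, ?_⟩
      rw [← congrFun hzy e₀, act_apply]
      simp [f]
    exact Submodule.finiteDimensional_of_le hle

theorem KoszulComplex.finite_deg (C : KoszulComplex T) (hT : T.IsConnected) (i : ℕ) :
    FiniteDimensional K (T.deg (i : ℤ)) := by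
  refine Kos.finite C C.exact ?_ i
  have : T.deg ((0 : ℕ) : ℤ) ≤ LinearMap.range (Algebra.linearMap K B) := by
    intro x hx
    obtain ⟨c, hc⟩ := hT.proj_zero x
    exact ⟨c, by rw [Algebra.linearMap_apply, ← hc]; exact hx⟩
  exact Submodule.finiteDimensional_of_le this

end Kos

/-! ### Syzygy modules with minimal homogeneous generators -/

section Stage

variable {ι K B : Type*} [AddCommGroup ι] [Field K] [CommRing B] [Algebra K B]
  {T : GradingProj ℤ K B}

theorem linearCombination_proj (G : GradingProj ι K B) {ν ν' : Type} [Fintype ν]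
    {α : ν → ι} {β : ν' → ι} {M : ν → ν' → B} (hM : ∀ i e, M i e ∈ G.deg (α i - β e))
    (x : ν → B) (k : ι) :
    Fintype.linearCombination B M (fun i => G.proj (k - α i) (x i)) =
      fun e => G.proj (k - β e) (Fintype.linearCombination B M x e) := by
  funext e
  simp only [Fintype.linearCombination_apply, Finset.sum_apply, Pi.smul_apply, smul_eq_mul, map_sum]
  refine Finset.sum_congr rfl fun i _ => ?_
  rw [GradingProj.proj_mul_of_mem (hM i e)]
  congr 3
  abel

/-- A syzygy module in a linear resolution, with a fine grading `Q` to be respected. -/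
structure Stage (C : KoszulComplex T) (Q : GradingProj ι K B) where
  t : ℕ
  β : Fin t → ι
  Z : Submodule B (Fin t → B)
  homT : ∀ z ∈ Z, ∀ k, (fun e => T.proj k (z e)) ∈ Z
  homQ : ∀ z ∈ Z, ∀ k, (fun e => Q.proj (k - β e) (z e)) ∈ Z
  pos : ∀ z ∈ Z, ∀ e, T.proj 0 (z e) = 0
  kos : Kos C.D (piece T Z)

/-- Minimal bihomogeneous generators of a syzygy module. -/
structure Stage.Gens {C : KoszulComplex T} {Q : GradingProj ι K B} (s : Stage C Q) where
  t : ℕ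
  β : Fin t → ι
  M : Fin t → Fin s.t → B
  M_mem : ∀ k, M k ∈ piece T s.Z 0
  M_deg : ∀ k e, M k e ∈ Q.deg (β k - s.β e)
  indep : LinearIndependent K M
  span : piece T s.Z 0 ≤ Submodule.span K (Set.range M)

/-- Selecting the basis inside a prescribed spanning set is what allows generators to be taken
bihomogeneous. -/
theorem exists_fin_basis {V : Type*} [AddCommGroup V] [Module K V] (U : Submodule K V)
    [FiniteDimensional K U] (s : Set V) (hs : Submodule.span K s = U) :
    ∃ (t : ℕ) (M : Fin t → V), (∀ k, M k ∈ s) ∧ LinearIndependent K M ∧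
      Submodule.span K (Set.range M) = U := by
  obtain ⟨b, hbs, hb, hli⟩ := exists_linearIndependent K s
  have : FiniteDimensional K (Submodule.span K (Set.range ((↑) : b → V))) := by
    rw [Subtype.range_coe, hb, hs]
    infer_instance
  have hfin : Finite b := Module.Finite.finite_basis (Module.Basis.span hli)
  cases nonempty_fintype b
  let f := Fintype.equivFin b
  refine ⟨Fintype.card b, fun k => f.symm k, fun k => hbs (f.symm k).2,
    hli.comp _ f.symm.injective, ?_⟩
  have : Set.range (fun k => ((f.symm k : b) : V)) = b := by
    rw [show (fun k => ((f.symm k : b) : V)) = Subtype.val ∘ f.symm from rfl,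
      f.symm.surjective.range_comp, Subtype.range_coe]
  rw [this, hb, hs]

variable {C : KoszulComplex T} {Q : GradingProj ι K B}

theorem Stage.finite_piece (hT : T.IsConnected) (s : Stage C Q) :
    FiniteDimensional K (piece T s.Z 0) := by
  have := C.finite_deg hT 1
  let f : piece T s.Z 0 →ₗ[K] (Fin s.t → T.deg ((1 : ℕ) : ℤ)) :=
    { toFun := fun z e => ⟨z.1 e, by simpa using z.2.2 e⟩
      map_add' := fun _ _ => rfl
      map_smul' := fun _ _ => rfl }
  refine FiniteDimensional.of_injective f fun x y h => ?_
  ext e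
  exact congrArg Subtype.val (congrFun h e)

/-- The lowest piece is stable under the projections of Q, since these commute with those of T, so
it is spanned by its Q-homogeneous elements; a basis is extracted from them. -/
theorem Stage.nonempty_gens (hT : T.IsConnected)
    (hTQ : ∀ k l x, T.proj k (Q.proj l x) = Q.proj l (T.proj k x)) (s : Stage C Q) :
    Nonempty s.Gens := by
  have := s.finite_piece hT
  obtain ⟨t, M, hM, hli, hspan⟩ := exists_fin_basis (piece T s.Z 0)
    {z | z ∈ piece T s.Z 0 ∧ ∃ k, ∀ e, z e ∈ Q.deg (k - s.β e)} (by
      refine le_antisymm (Submodule.span_le.2 fun z hz => hz.1) fun z hz => ?_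
      obtain ⟨S, hS⟩ := Q.exists_sum_pi s.β z
      rw [← hS]
      refine Submodule.sum_mem _ fun k _ => Submodule.subset_span
        ⟨⟨s.homQ z hz.1 k, fun e => ?_⟩, k, fun e => GradingProj.proj_mem _ _⟩
      rw [GradingProj.mem_deg, hTQ, GradingProj.mem_deg.1 (hz.2 e)])
  choose β hβ using fun k => (hM k).2
  exact ⟨⟨t, β, M, fun k => (hM k).1, hβ, hli, hspan.ge⟩⟩

/-- The constant part of a relation is again a relation, by homogeneity, and independence over K
makes its coefficients vanish. This is minimality of the resolution. -/
theorem pos_of_homogeneous (hT : T.IsConnected) {N : Type*} [AddCommGroup N] [Module K N]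
    [Module B N] [IsScalarTower K B N] {ν : Type} [Fintype ν] {M : ν → N}
    (hli : LinearIndependent K M)
    (hom : ∀ x ∈ LinearMap.ker (Fintype.linearCombination B M), ∀ k,
      (fun e => T.proj k (x e)) ∈ LinearMap.ker (Fintype.linearCombination B M))
    {x : ν → B} (hx : x ∈ LinearMap.ker (Fintype.linearCombination B M)) (e : ν) :
    T.proj 0 (x e) = 0 := by
  choose c hc using fun e => hT.proj_zero (x e)
  have h := LinearMap.mem_ker.1 (hom x hx 0)
  simp only [Fintype.linearCombination_apply, hc, algebraMap_smul] at h
  rw [hc, Fintype.linearIndependent_iff.1 hli c h e, map_zero]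

variable {s : Stage C Q}

theorem Stage.Gens.mem_deg_one (g : s.Gens) (k : Fin g.t) (e : Fin s.t) : g.M k e ∈ T.deg 1 := by
  simpa using (g.M_mem k).2 e

theorem Stage.Gens.map_mem (g : s.Gens) (i : ℕ) (x : Fin g.t → B)
    (hx : ∀ e, x e ∈ T.deg (i : ℤ)) : Fintype.linearCombination B g.M x ∈ piece T s.Z i := by
  rw [Fintype.linearCombination_apply]
  refine ⟨Submodule.sum_mem _ fun k _ => Submodule.smul_mem _ _ (g.M_mem k).1, fun e => ?_⟩
  rw [Finset.sum_apply]
  refine Submodule.sum_mem _ fun k _ => ?_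
  push_cast
  exact GradingProj.mul_mem (hx k) (g.mem_deg_one k e)

/-- Components of degree at most zero vanish by connectedness and minimality; those of positive
degree come from the lowest piece because `Kos` forces generation in one degree. -/
theorem Stage.Gens.range_eq (g : s.Gens) (hT : T.IsConnected) :
    LinearMap.range (Fintype.linearCombination B g.M) = s.Z := by
  apply le_antisymm
  · rintro _ ⟨x, rfl⟩
    rw [Fintype.linearCombination_apply]
    exact Submodule.sum_mem _ fun k _ => Submodule.smul_mem _ _ (g.M_mem k).1
  · intro z hz
    obtain ⟨S, hS⟩ := T.exists_sum_pi (fun _ => 0) z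
    rw [← hS]
    refine Submodule.sum_mem _ fun k _ => ?_
    simp only [sub_zero]
    rcases lt_trichotomy k 0 with hk | rfl | hk
    · simp only [hT.proj_neg k hk]
      exact Submodule.zero_mem _
    · simp only [s.pos z hz]
      exact Submodule.zero_mem _
    · obtain ⟨i, rfl⟩ : ∃ i : ℕ, k = ((i + 1 : ℕ) : ℤ) := ⟨(k - 1).toNat, by omega⟩
      obtain ⟨x, -, hx⟩ := Kos.exists_lift C s.kos g.span i _
        ⟨s.homT z hz _, fun e => GradingProj.proj_mem _ _⟩
      exact ⟨x, hx⟩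

theorem Stage.Gens.homT_ker (g : s.Gens) (z : Fin g.t → B)
    (hz : z ∈ LinearMap.ker (Fintype.linearCombination B g.M)) (k : ℤ) :
    (fun e => T.proj k (z e)) ∈ LinearMap.ker (Fintype.linearCombination B g.M) := by
  have h := linearCombination_proj T (α := fun _ => 1) (β := fun _ => 0) (M := g.M)
    (fun k e => by simpa using g.mem_deg_one k e) z (k + 1)
  simp only [add_sub_cancel_right, sub_zero] at h
  rw [LinearMap.mem_ker, h, LinearMap.mem_ker.1 hz]
  simp only [Pi.zero_apply, map_zero]
  rfl

/-- The next syzygy module. -/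
def Stage.Gens.next (g : s.Gens) (hT : T.IsConnected) : Stage C Q where
  t := g.t
  β := g.β
  Z := LinearMap.ker (Fintype.linearCombination B g.M)
  homQ := fun z hz k => by
    rw [LinearMap.mem_ker, linearCombination_proj Q g.M_deg, LinearMap.mem_ker.1 hz]
    simp only [Pi.zero_apply, map_zero]
    rfl
  homT := g.homT_ker
  pos := fun z hz e => pos_of_homogeneous hT g.indep g.homT_ker hz e
  kos := Kos.ker C s.kos _ g.map_mem (Kos.exists_lift C s.kos g.span)

end Stage

/-! ### From the exactness criterion to linear resolutions and back -/

section Resolution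

variable {ι K B : Type*} [AddCommGroup ι] [Field K] [CommRing B] [Algebra K B]
  {T : GradingProj ℤ K B} {C : KoszulComplex T} {Q : GradingProj ι K B}

/-- A choice of minimal bihomogeneous generators. -/
noncomputable def Stage.gens (hT : T.IsConnected)
    (hTQ : ∀ k l x, T.proj k (Q.proj l x) = Q.proj l (T.proj k x)) (s : Stage C Q) : s.Gens :=
  (s.nonempty_gens hT hTQ).some

/-- The iterated syzygy modules. -/
noncomputable def Stage.seq (hT : T.IsConnected)
    (hTQ : ∀ k l x, T.proj k (Q.proj l x) = Q.proj l (T.proj k x)) (s : Stage C Q) :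
    ℕ → Stage C Q
  | 0 => s
  | n + 1 => ((s.seq hT hTQ n).gens hT hTQ).next hT

/-- The matrices of the minimal resolution. -/
noncomputable def Stage.mat (hT : T.IsConnected)
    (hTQ : ∀ k l x, T.proj k (Q.proj l x) = Q.proj l (T.proj k x)) (s : Stage C Q) (n : ℕ) :
    Fin (s.seq hT hTQ (n + 1)).t → Fin (s.seq hT hTQ n).t → B :=
  ((s.seq hT hTQ n).gens hT hTQ).M

section

variable (hT : T.IsConnected) (hTQ : ∀ k l x, T.proj k (Q.proj l x) = Q.proj l (T.proj k x))
  (s : Stage C Q) (n : ℕ)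

theorem Stage.mat_mem_deg (k e) : s.mat hT hTQ n k e ∈ T.deg 1 :=
  ((s.seq hT hTQ n).gens hT hTQ).mem_deg_one k e

theorem Stage.mat_mem_fine (k e) : s.mat hT hTQ n k e ∈
    Q.deg ((s.seq hT hTQ (n + 1)).β k - (s.seq hT hTQ n).β e) :=
  ((s.seq hT hTQ n).gens hT hTQ).M_deg k e

theorem Stage.mat_ne_zero (k) : s.mat hT hTQ n k ≠ 0 :=
  ((s.seq hT hTQ n).gens hT hTQ).indep.ne_zero k

theorem Stage.range_mat : LinearMap.range (Fintype.linearCombination B (s.mat hT hTQ n)) =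
    (s.seq hT hTQ n).Z :=
  ((s.seq hT hTQ n).gens hT hTQ).range_eq hT

theorem Stage.ker_mat : LinearMap.ker (Fintype.linearCombination B (s.mat hT hTQ n)) =
    (s.seq hT hTQ (n + 1)).Z :=
  rfl

end

theorem hasLinearResolution_of_stage (hT : T.IsConnected)
    (hTQ : ∀ k l x, T.proj k (Q.proj l x) = Q.proj l (T.proj k x)) (s : Stage C Q)
    {N : Type*} [AddCommGroup N] [Module K N] [Module B N] {𝒜 : ℕ → Submodule K B}
    (h𝒜 : T.deg 1 ≤ 𝒜 1) {ℳ : ℤ → Submodule K N} {a : ℤ} (φ : (Fin s.t → B) →ₗ[B] N)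
    (hφ : Function.Surjective φ) (hker : LinearMap.ker φ = s.Z)
    (hmem : ∀ k, φ (Pi.single k 1) ∈ ℳ a) : HasLinearResolution 𝒜 ℳ a := by
  refine ⟨⟨fun n => (s.seq hT hTQ n).t, fun n => Fintype.linearCombination B (s.mat hT hTQ n), φ,
    fun n k l => ?_, hmem, hφ, ?_, fun n => ?_⟩⟩
  · rw [Fintype.linearCombination_apply_single, one_smul]
    exact h𝒜 (s.mat_mem_deg hT hTQ n k l)
  · exact LinearMap.exact_iff.2 (hker.trans (s.range_mat hT hTQ 0).symm)
  · rw [LinearMap.exact_iff, s.ker_mat hT hTQ n, s.range_mat hT hTQ (n + 1)]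

/-- A K-basis of the lowest piece generates N, and the relations among its elements form a stage.
The maps `p` stand in for the projections of N; they serve only to show that these relations are
homogeneous. -/
theorem hasLinearResolution_of_kos (C : KoszulComplex T) (hT : T.IsConnected)
    {N : Type*} [AddCommGroup N] [Module K N] [Module B N] [IsScalarTower K B N]
    {𝒜 : ℕ → Submodule K B} (h𝒜 : T.deg 1 ≤ 𝒜 1) {ℳ : ℤ → Submodule K N} {a : ℤ}
    {𝒩 : ℕ → Submodule K N} (hN : Kos C.D 𝒩) [FiniteDimensional K (𝒩 0)]
    (htop : ⨆ i, 𝒩 i = ⊤) (p : ℤ → N →+ N)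
    (hp : ∀ k b, ∀ m ∈ 𝒩 0, p k (b • m) = T.proj k b • m)
    (hmul : ∀ (i : ℕ) b, ∀ m ∈ 𝒩 0, b ∈ T.deg (i : ℤ) → b • m ∈ 𝒩 i)
    (hle : 𝒩 0 ≤ ℳ a) : HasLinearResolution 𝒜 ℳ a := by
  obtain ⟨t, M, hM, hli, hspan⟩ := exists_fin_basis (𝒩 0) (𝒩 0 : Set N) (Submodule.span_eq _)
  have hom (x : Fin t → B) (hx : x ∈ LinearMap.ker (Fintype.linearCombination B M)) (k : ℤ) :
      (fun e => T.proj k (x e)) ∈ LinearMap.ker (Fintype.linearCombination B M) := by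
    rw [LinearMap.mem_ker, Fintype.linearCombination_apply] at hx ⊢
    rw [← map_zero (p k), ← hx, map_sum]
    exact Finset.sum_congr rfl fun i _ => (hp k _ _ (hM i)).symm
  have hlift := Kos.exists_lift C hN hspan.ge
  let s : Stage C (GradingProj.trivial K B) :=
    { t := t
      β := 0
      Z := LinearMap.ker (Fintype.linearCombination B M)
      homT := hom
      homQ := fun z hz _ => hz
      pos := fun z hz e => pos_of_homogeneous hT hli hom hz e
      kos := Kos.ker C hN _ (fun i x hx => by
        rw [Fintype.linearCombination_apply]
        exact Submodule.sum_mem _ fun k _ => hmul i _ _ (hM k) (hx k)) hlift }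
  refine hasLinearResolution_of_stage hT (fun _ _ _ => rfl) s h𝒜 (Fintype.linearCombination B M)
    ?_ rfl fun k => ?_
  · rw [← LinearMap.range_eq_top, ← Submodule.restrictScalars_eq_top_iff K, eq_top_iff, ← htop]
    refine iSup_le fun i y hy => ?_
    obtain ⟨x, -, hx⟩ := hlift i y hy
    exact ⟨x, hx⟩
  · rw [Fintype.linearCombination_apply_single, one_smul]
    exact hle (hM k)

theorem hasLinearResolution_of_subsingleton {N : Type*} [AddCommGroup N] [Module K N] [Module B N]
    [Subsingleton N] (𝒜 : ℕ → Submodule K B) (ℳ : ℤ → Submodule K N) (a : ℤ) :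
    HasLinearResolution 𝒜 ℳ a :=
  ⟨⟨fun _ => 0, fun _ => 0, 0, fun _ k => k.elim0, fun k => k.elim0,
    Function.surjective_to_subsingleton _, fun _ => ⟨fun _ => ⟨0, Subsingleton.elim _ _⟩,
      fun _ => Subsingleton.elim _ _⟩, fun _ _ => ⟨fun _ => ⟨0, Subsingleton.elim _ _⟩,
      fun _ => Subsingleton.elim _ _⟩⟩⟩

/-- In a nonnegative grading, the degree zero part of a product bx can only involve the degree zero
part of x, so the condition passes to the ideal generated. -/
theorem proj_zero_eq_zero_of_mem (hT : T.IsConnected) {𝒯 : ℕ → Submodule K B}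
    (h𝒯 : ∀ i : ℕ, 𝒯 i = T.deg (i : ℤ)) {x : B} (hx : x ∈ irrelevantIdeal 𝒯) :
    T.proj 0 x = 0 := by
  refine Submodule.span_induction ?_ (map_zero _) (fun x y _ _ hx hy => ?_)
    (fun b x _ hx => ?_) hx
  · rintro x ⟨i, hi, hx⟩
    rw [h𝒯] at hx
    exact GradingProj.proj_of_mem_ne hx (by omega)
  · rw [map_add, hx, hy, add_zero]
  · obtain ⟨S, hS⟩ := T.exists_sum x
    rw [smul_eq_mul, ← hS, Finset.mul_sum, map_sum]
    refine Finset.sum_eq_zero fun k _ => ?_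
    rw [GradingProj.proj_mul_of_mem (GradingProj.proj_mem k x)]
    rcases lt_trichotomy k 0 with hk | rfl | hk
    · rw [hT.proj_neg k hk, mul_zero]
    · rw [hx, mul_zero]
    · rw [hT.proj_neg _ (by omega), zero_mul]

theorem mem_irrelevantIdeal_iff (hT : T.IsConnected) {𝒯 : ℕ → Submodule K B}
    (h𝒯 : ∀ i : ℕ, 𝒯 i = T.deg (i : ℤ)) {x : B} : x ∈ irrelevantIdeal 𝒯 ↔ T.proj 0 x = 0 := by
  refine ⟨proj_zero_eq_zero_of_mem hT h𝒯, fun hx => ?_⟩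
  obtain ⟨S, hS⟩ := T.exists_sum x
  rw [← hS]
  refine Submodule.sum_mem _ fun k _ => ?_
  rcases lt_trichotomy k 0 with hk | rfl | hk
  · rw [hT.proj_neg k hk]
    exact Submodule.zero_mem _
  · rw [hx]
    exact Submodule.zero_mem _
  · obtain ⟨i, rfl⟩ : ∃ i : ℕ, k = (i : ℤ) := ⟨k.toNat, by omega⟩
    exact Submodule.subset_span ⟨i, by omega, h𝒯 i ▸ GradingProj.proj_mem _ _⟩

theorem linearMap_eq_act {m n : Type} [Fintype m] [DecidableEq m]
    (f : (m → B) →ₗ[B] (n → B)) (y : m → B) : f y = act (fun k => f (Pi.single k 1)) y := by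
  conv_lhs => rw [← LinearMap.sum_single_apply (fun _ : m => B) y, map_sum]
  funext j
  rw [act_apply, Finset.sum_apply]
  refine Finset.sum_congr rfl fun k _ => ?_
  have : Pi.single k (y k) = y k • (Pi.single k 1 : m → B) := by
    rw [← Pi.single_smul, smul_eq_mul, mul_one]
  rw [this, map_smul, Pi.smul_apply, smul_eq_mul, smul_eq_mul, mul_comm]

/-- The homogeneous part of a solution of a linear system with coefficients of degree one. -/
theorem act_proj {m n : Type} [Fintype m] {D : m → n → B} (hD : ∀ k l, D k l ∈ T.deg 1)
    (y : m → B) (k : ℤ) :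
    act D (fun i => T.proj k (y i)) = fun j => T.proj (k + 1) (act D y j) := by
  funext j
  simp only [act_apply, map_sum, smul_eq_mul]
  refine Finset.sum_congr rfl fun i _ => ?_
  rw [mul_comm, mul_comm (D i j), GradingProj.proj_mul_of_mem (hD i j), add_sub_cancel_right]

/-- A linear resolution of the residue class field gives a Koszul complex. -/
theorem IsKoszul.nonempty_koszulComplex (hT : T.IsConnected) {𝒯 : ℕ → Submodule K B}
    (h𝒯 : ∀ i : ℕ, 𝒯 i = T.deg (i : ℤ)) [Nontrivial B] (h : IsKoszul 𝒯) :
    Nonempty (KoszulComplex T) := by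
  obtain ⟨R⟩ := h
  have hd (n : ℕ) (y) : R.d n y = act (fun k => R.d n (Pi.single k 1)) y := linearMap_eq_act _ _
  have hmem (n : ℕ) (k l) : R.d n (Pi.single k 1) l ∈ T.deg 1 := by
    have := R.d_entry_mem n k l
    rw [h𝒯] at this
    exact_mod_cast this
  refine ⟨⟨fun n => Fin (R.rank n), fun n => inferInstance, fun n k => R.d n (Pi.single k 1),
    hmem, fun n k l => ?_, ?_, ?_⟩⟩
  · have := congrFun (((R.exact_succ n).apply_apply_eq_zero (Pi.single k 1))) l
    rw [hd n, act_apply, Pi.zero_apply] at this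
    rw [← this]
    exact Finset.sum_congr rfl fun j _ => mul_comm _ _
  · intro n i x hx hc
    have hex : ∃ y, R.d n y = x := by
      cases n with
      | zero =>
        -- Elements of positive degree act as zero on the residue field, so x is in the kernel of
        -- the augmentation.
        refine (R.exact_zero x).1 ?_
        rw [← LinearMap.sum_single_apply (fun _ => B) x, map_sum]
        refine Finset.sum_eq_zero fun k _ => ?_
        have : Pi.single k (x k) = x k • (Pi.single k 1 : Fin (R.rank 0) → B) := by
          rw [← Pi.single_smul, smul_eq_mul, mul_one]
        rw [this, map_smul]
        obtain ⟨b, hb⟩ := Ideal.Quotient.mk_surjective (R.aug (Pi.single k 1))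
        rw [← hb, ← Ideal.Quotient.mk_eq_mk, ← Submodule.Quotient.mk_smul,
          Submodule.Quotient.mk_eq_zero]
        refine Ideal.mul_mem_right _ _ (Submodule.subset_span ⟨i + 1, by omega, ?_⟩)
        rw [h𝒯]
        exact hx k
      | succ n => exact (R.exact_succ n x).1 ((hd n x).trans hc)
    obtain ⟨y, hy⟩ := hex
    rw [hd] at hy
    -- The primitive obtained from exactness is not homogeneous; since the matrix is linear, its
    -- component of degree i already suffices.
    refine ⟨fun k => T.proj i (y k), fun k => GradingProj.proj_mem _ _, ?_⟩
    rw [act_proj (hmem n), hy]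
    funext k
    exact_mod_cast hx k
  · by_contra hne
    have hsub : Subsingleton (Fin (R.rank 0) → B) :=
      ⟨fun f g => funext fun k => (hne ⟨k⟩).elim⟩
    have : Subsingleton (B ⧸ irrelevantIdeal 𝒯) := R.aug_surjective.subsingleton
    have h1 : (1 : B) ∈ irrelevantIdeal 𝒯 := by
      rw [← Submodule.Quotient.mk_eq_zero]
      exact Subsingleton.elim _ _
    rw [mem_irrelevantIdeal_iff hT h𝒯, T.proj_one] at h1
    exact one_ne_zero h1

/-- The first syzygy module of the residue class field. -/
noncomputable def residueStage (C : KoszulComplex T) (Q : GradingProj ι K B) (hT : T.IsConnected)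
    (hTQ : ∀ k l x, T.proj k (Q.proj l x) = Q.proj l (T.proj k x)) {𝒯 : ℕ → Submodule K B}
    (h𝒯 : ∀ i : ℕ, 𝒯 i = T.deg (i : ℤ)) : Stage C Q where
  t := 1
  β := 0
  Z := LinearMap.ker ((irrelevantIdeal 𝒯).mkQ.comp (LinearMap.proj (0 : Fin 1)))
  homT := fun z hz k => by
    simp only [LinearMap.mem_ker, LinearMap.comp_apply, LinearMap.proj_apply, Submodule.mkQ_apply,
      Submodule.Quotient.mk_eq_zero, mem_irrelevantIdeal_iff hT h𝒯] at hz ⊢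
    by_cases hk : 0 = k
    · rw [← hk, hz, map_zero]
    · exact T.proj_ne _ _ _ hk
  homQ := fun z hz k => by
    simp only [LinearMap.mem_ker, LinearMap.comp_apply, LinearMap.proj_apply, Submodule.mkQ_apply,
      Submodule.Quotient.mk_eq_zero, mem_irrelevantIdeal_iff hT h𝒯] at hz ⊢
    rw [hTQ, hz, map_zero]
  pos := fun z hz e => by
    simp only [LinearMap.mem_ker, LinearMap.comp_apply, LinearMap.proj_apply, Submodule.mkQ_apply,
      Submodule.Quotient.mk_eq_zero, mem_irrelevantIdeal_iff hT h𝒯] at hz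
    rwa [Subsingleton.elim e 0]
  kos := by
    -- The residue field lives in degree zero, so its exactness in positive degrees is vacuous, and
    -- the criterion passes to the irrelevant ideal as its first syzygy.
    refine Kos.ker C (𝒩 := fun i => if i = 0 then ⊤ else ⊥) ?_ _ ?_ ?_
    · intro n i x hx _
      refine ⟨0, fun _ => Submodule.zero_mem _, ?_⟩
      rw [map_zero]
      funext k
      simpa using (hx k).symm
    · intro i x hx
      by_cases hi : i = 0
      · simp [hi]
      · simp only [hi, if_false, Submodule.mem_bot, LinearMap.comp_apply, LinearMap.proj_apply,
          Submodule.mkQ_apply, Submodule.Quotient.mk_eq_zero, mem_irrelevantIdeal_iff hT h𝒯]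
        exact GradingProj.proj_of_mem_ne (hx 0) (by omega)
    · intro i y hy
      by_cases hi : i = 0
      · subst hi
        obtain ⟨b, rfl⟩ := Submodule.Quotient.mk_surjective _ y
        refine ⟨fun _ => T.proj 0 b, fun _ => GradingProj.proj_mem _ _, ?_⟩
        simp only [LinearMap.comp_apply, LinearMap.proj_apply, Submodule.mkQ_apply]
        rw [Submodule.Quotient.eq, mem_irrelevantIdeal_iff hT h𝒯, map_sub, T.proj_self, sub_self]
      · simp only [hi, if_false, Submodule.mem_bot] at hy
        exact ⟨0, fun _ => Submodule.zero_mem _, by rw [map_zero, hy]⟩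

end Resolution

/-! ### Gradings as coactions of a group algebra -/

section Coaction

open AddMonoidAlgebra

variable {ι K B : Type*} [AddCommGroup ι] [Field K] [CommRing B] [Algebra K B]

/-- Coassociativity of the coaction: by additivity it is enough to check it on the homogeneous
elements of H, which generate B additively. The counit law `coaction_sum` is handled in the same
way. -/
theorem coaction_proj (Φ : B →+* AddMonoidAlgebra B ι)
    {H : Set B} (hH : ∀ h ∈ H, ∃ k, Φ h = single k h) (hspan : AddSubgroup.closure H = ⊤) (x : B)
    (k : ι) : Φ ((Φ x).coeff k) = single k ((Φ x).coeff k) := by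
  have hx : x ∈ AddSubgroup.closure H := hspan ▸ AddSubgroup.mem_top x
  induction hx using AddSubgroup.closure_induction with
  | mem x hx =>
    obtain ⟨l, hl⟩ := hH x hx
    rw [hl]
    by_cases h : l = k
    · subst h
      simp [hl]
    · simp [coeff_single, h]
  | zero => simp
  | add x y _ _ hx hy => simp [hx, hy]
  | neg x _ hx => simp [hx]

theorem coaction_sum (Φ : B →+* AddMonoidAlgebra B ι)
    {H : Set B} (hH : ∀ h ∈ H, ∃ k, Φ h = single k h) (hspan : AddSubgroup.closure H = ⊤) (x : B) :
    (Finsupp.liftAddHom fun _ : ι => AddMonoidHom.id B) (Φ x).coeff = x := by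
  have hx : x ∈ AddSubgroup.closure H := hspan ▸ AddSubgroup.mem_top x
  induction hx using AddSubgroup.closure_induction with
  | mem x hx =>
    obtain ⟨l, hl⟩ := hH x hx
    rw [hl]
    simp [coeff_single]
  | zero => simp
  | add x y _ _ hx hy =>
    rw [map_add, coeff_add, map_add, hx, hy]
  | neg x _ hx =>
    rw [map_neg, coeff_neg, map_neg, hx]

/-- The grading defined by a coaction of the group algebra of `ι`. -/
noncomputable def GradingProj.ofCoaction (Φ : B →+* AddMonoidAlgebra B ι)
    (hK : ∀ c : K, Φ (algebraMap K B c) = single 0 (algebraMap K B c))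
    {H : Set B} (hH : ∀ h ∈ H, ∃ k, Φ h = single k h) (hspan : AddSubgroup.closure H = ⊤) :
    GradingProj ι K B where
  proj k :=
    { toFun := fun x => (Φ x).coeff k
      map_add' := fun x y => by simp
      map_smul' := fun c x => by
        rw [Algebra.smul_def, map_mul, hK, coeff_single_mul_apply, RingHom.id_apply,
          Algebra.smul_def, neg_zero, zero_add] }
  proj_self k x := by
    simp [coaction_proj Φ hH hspan]
  proj_ne k l x h := by
    simp [coaction_proj Φ hH hspan, coeff_single, h.symm]
  exists_sum x := ⟨(Φ x).coeff.support, coaction_sum Φ hH hspan x⟩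
  proj_mul k l x y hy := by
    have h := coaction_proj Φ hH hspan y l
    change (Φ y).coeff l = y at hy
    rw [hy] at h
    change (Φ (x * y)).coeff k = (Φ x).coeff (k - l) * y
    rw [map_mul, h, coeff_mul_single_apply, sub_eq_add_neg]
  proj_one := by
    change (Φ 1).coeff 0 = 1
    rw [map_one, one_def, coeff_single, Finsupp.single_eq_same]

theorem GradingProj.mem_deg_ofCoaction {Φ : B →+* AddMonoidAlgebra B ι}
    {hK : ∀ c : K, Φ (algebraMap K B c) = single 0 (algebraMap K B c)}
    {H : Set B} {hH : ∀ h ∈ H, ∃ k, Φ h = single k h} {hspan : AddSubgroup.closure H = ⊤}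
    {k : ι} {x : B} (hx : Φ x = single k x) :
    x ∈ (GradingProj.ofCoaction Φ hK hH hspan).deg k := by
  change (Φ x).coeff k = x
  rw [hx, coeff_single, Finsupp.single_eq_same]

end Coaction

/-! ### The grading of the base algebra as a coaction -/

section Base

open AddMonoidAlgebra

variable {K A R : Type*} [Field K] [CommRing A] [Algebra K A] [CommRing R] [Algebra K R]
  (𝒜 : ℕ → Submodule K A) [GradedAlgebra 𝒜]

/-- The algebra homomorphism sending `a` of degree `i` to `g(a) T ^ (c i)`. -/
noncomputable def baseCoaction (g : A →ₐ[K] R) (c : ℤ) : A →ₐ[K] AddMonoidAlgebra R ℤ :=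
  (DirectSum.toAlgebra K (fun i => 𝒜 i)
    (fun i => (AddMonoidAlgebra.lsingle (c * i)).comp (g.toLinearMap.comp (𝒜 i).subtype))
    (by
      change single (c * ((0 : ℕ) : ℤ)) (g 1) = 1
      rw [map_one, Nat.cast_zero, mul_zero, one_def]) (fun {i j} a b => by
      change single (c * ((i + j : ℕ) : ℤ)) (g (a * b)) = single (c * (i : ℤ)) (g a) *
        single (c * (j : ℤ)) (g b)
      rw [single_mul_single, map_mul, Nat.cast_add, mul_add])).comp (DirectSum.decomposeAlgEquiv 𝒜).toAlgHom

theorem baseCoaction_apply (g : A →ₐ[K] R) (c : ℤ) {i : ℕ} {a : A} (ha : a ∈ 𝒜 i) :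
    baseCoaction 𝒜 g c a = single (c * i) (g a) := by
  simp only [baseCoaction, AlgHom.comp_apply]
  have : (DirectSum.decomposeAlgEquiv 𝒜).toAlgHom a = DirectSum.of (fun i => 𝒜 i) i ⟨a, ha⟩ :=
    DirectSum.decompose_of_mem 𝒜 ha
  rw [this]
  exact DirectSum.toAddMonoid_of
    (fun j => (((AddMonoidAlgebra.lsingle (c * j)).comp
      (g.toLinearMap.comp (𝒜 j).subtype)).toAddMonoidHom : 𝒜 j →+ AddMonoidAlgebra R ℤ))
    i (⟨a, ha⟩ : 𝒜 i)

theorem closure_homogeneous : AddSubgroup.closure {a : A | ∃ i, a ∈ 𝒜 i} = ⊤ := by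
  classical
  rw [eq_top_iff]
  intro a _
  rw [← DirectSum.sum_support_decompose 𝒜 a]
  exact sum_mem fun i _ => AddSubgroup.subset_closure ⟨i, SetLike.coe_mem _⟩

/-- The given grading of the base algebra. -/
noncomputable def baseGrading : GradingProj ℤ K A :=
  GradingProj.ofCoaction (baseCoaction 𝒜 (AlgHom.id K A) 1).toRingHom
    (fun c => by
      have := baseCoaction_apply 𝒜 (AlgHom.id K A) 1 (SetLike.algebraMap_mem_graded 𝒜 c)
      simp only [Nat.cast_zero, mul_zero] at this
      exact this)
    (H := {a : A | ∃ i, a ∈ 𝒜 i})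
    (fun a ⟨i, ha⟩ => ⟨_, baseCoaction_apply 𝒜 (AlgHom.id K A) 1 ha⟩) (closure_homogeneous 𝒜)

theorem mem_baseGrading {i : ℕ} {a : A} (ha : a ∈ 𝒜 i) : a ∈ (baseGrading 𝒜).deg (i : ℤ) := by
  refine GradingProj.mem_deg_ofCoaction ?_
  have := baseCoaction_apply 𝒜 (AlgHom.id K A) 1 ha
  rwa [one_mul] at this

theorem baseGrading_deg (i : ℕ) : 𝒜 i = (baseGrading 𝒜).deg (i : ℤ) := by
  classical
  refine le_antisymm (fun a ha => mem_baseGrading 𝒜 ha) fun a ha => ?_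
  rw [← GradingProj.mem_deg.1 ha, ← DirectSum.sum_support_decompose 𝒜 a, map_sum]
  refine sum_mem fun j _ => ?_
  have h := mem_baseGrading 𝒜 (SetLike.coe_mem (DirectSum.decompose 𝒜 a j))
  by_cases hij : i = j
  · subst hij
    rw [GradingProj.mem_deg.1 h]
    exact SetLike.coe_mem _
  · rw [GradingProj.proj_of_mem_ne h (by exact_mod_cast hij)]
    exact Submodule.zero_mem _

theorem baseGrading_connected (h0 : 𝒜 0 = 1) : (baseGrading 𝒜).IsConnected := by
  classical
  constructor
  · intro k hk a
    rw [← DirectSum.sum_support_decompose 𝒜 a, map_sum]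
    exact Finset.sum_eq_zero fun j _ => GradingProj.proj_of_mem_ne
      (mem_baseGrading 𝒜 (SetLike.coe_mem (DirectSum.decompose 𝒜 a j))) (by omega)
  · intro a
    have : (baseGrading 𝒜).proj 0 a ∈ 𝒜 0 := by
      rw [baseGrading_deg 𝒜 0]
      exact GradingProj.proj_mem _ _
    rw [h0, Submodule.mem_one] at this
    obtain ⟨c, hc⟩ := this
    exact ⟨c, hc.symm⟩

end Base

/-! ### Gradings of the symmetric algebra -/

section SymCoaction

open AddMonoidAlgebra

variable {K A M : Type*} [Field K] [CommRing A] [Algebra K A] [AddCommGroup M] [Module K M]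
  [Module A M] [IsScalarTower K A M] {𝒜 : ℕ → Submodule K A} [GradedAlgebra 𝒜]
  {ℳ : ℤ → Submodule K M}

theorem algebraMap_sym (c : K) : algebraMap K (SymmetricAlgebra A M) c =
    algebraMap A (SymmetricAlgebra A M) (algebraMap K A c) :=
  IsScalarTower.algebraMap_apply K A (SymmetricAlgebra A M) c

omit [IsScalarTower K A M] [GradedAlgebra 𝒜] in
theorem IsGradedModule.induction (hM : IsGradedModule 𝒜 ℳ) {p : M → Prop}
    (mem : ∀ k, ∀ m ∈ ℳ k, p m) (zero : p 0) (add : ∀ x y, p x → p y → p (x + y)) (m : M) :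
    p m := by
  classical
  obtain ⟨x, rfl⟩ := hM.isInternal.2 m
  induction x using DirectSum.induction_on with
  | zero => rwa [map_zero]
  | of k x =>
    rw [DirectSum.coeAddMonoidHom_of]
    exact mem k _ x.2
  | add x y hx hy =>
    rw [map_add]
    exact add _ _ hx hy

omit [IsScalarTower K A M] [GradedAlgebra 𝒜] in
theorem IsGradedModule.exists_addMonoidHom (hM : IsGradedModule 𝒜 ℳ) {R : Type*} [AddCommMonoid R]
    (f : ℤ → M →+ R) : ∃ F : M →+ R, ∀ k, ∀ m ∈ ℳ k, F m = f k m := by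
  classical
  let E := AddEquiv.ofBijective (DirectSum.coeAddMonoidHom ℳ) hM.isInternal
  refine ⟨(DirectSum.toAddMonoid fun k => (f k).comp (ℳ k).subtype.toAddMonoidHom).comp
    E.symm.toAddMonoidHom, fun k m hm => ?_⟩
  have : E.symm m = DirectSum.of (fun k => ℳ k) k ⟨m, hm⟩ := by
    rw [AddEquiv.symm_apply_eq]
    exact (DirectSum.coeAddMonoidHom_of ℳ k ⟨m, hm⟩).symm
  change DirectSum.toAddMonoid _ (E.symm m) = _
  rw [this, DirectSum.toAddMonoid_of]
  rfl

theorem exists_symLift {R : Type*} [CommRing R] (f : A →+* R) (F : M →+ R)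
    (hF : ∀ a m, F (a • m) = f a * F m) : ∃ Φ : SymmetricAlgebra A M →+* R,
      (∀ a, Φ (algebraMap A _ a) = f a) ∧ ∀ m, Φ (SymmetricAlgebra.ι A M m) = F m := by
  let _ : Algebra A R := f.toAlgebra
  let F' : M →ₗ[A] R :=
    { F with map_smul' := fun a m => (hF a m).trans (Algebra.smul_def a _).symm }
  exact ⟨(SymmetricAlgebra.lift F').toRingHom, (SymmetricAlgebra.lift F').commutes,
    SymmetricAlgebra.lift_ι_apply F'⟩

/-- The universal property of the symmetric algebra reduces this to compatible weights on A and M.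
The weight c(k - e) + d is affine of slope c in the degree k, so multiplication by A_i adds ci.
Elements of M_e get weight d, hence bidegree (i, j) gets ci + dj. Building the gradings in this way
avoids a direct proof that the bigraded pieces are independent. -/
theorem exists_symCoaction (hM : IsGradedModule 𝒜 ℳ) (e c d : ℤ) :
    ∃ Φ : SymmetricAlgebra A M →+* AddMonoidAlgebra (SymmetricAlgebra A M) ℤ,
      (∀ i : ℕ, ∀ a ∈ 𝒜 i, Φ (algebraMap A _ a) = single (c * i) (algebraMap A _ a)) ∧
      ∀ k, ∀ m ∈ ℳ k, Φ (SymmetricAlgebra.ι A M m) =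
        single (c * (k - e) + d) (SymmetricAlgebra.ι A M m) := by
  let f : A →+* AddMonoidAlgebra (SymmetricAlgebra A M) ℤ :=
    (baseCoaction 𝒜 (IsScalarTower.toAlgHom K A (SymmetricAlgebra A M)) c).toRingHom
  have hf (i : ℕ) (a : A) (ha : a ∈ 𝒜 i) : f a = single (c * i) (algebraMap A _ a) :=
    baseCoaction_apply 𝒜 _ c ha
  obtain ⟨F, hF⟩ := hM.exists_addMonoidHom
    (fun k => (AddMonoidAlgebra.singleAddHom (c * (k - e) + d)).comp
      (SymmetricAlgebra.ι A M).toAddMonoidHom)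
  replace hF (k : ℤ) (m : M) (hm : m ∈ ℳ k) :
      F m = single (c * (k - e) + d) (SymmetricAlgebra.ι A M m) := hF k m hm
  have hFf (a : A) (m : M) : F (a • m) = f a * F m := by
    have ha : a ∈ AddSubgroup.closure {a : A | ∃ i, a ∈ 𝒜 i} := by
      rw [closure_homogeneous]
      exact AddSubgroup.mem_top a
    induction ha using AddSubgroup.closure_induction with
    | mem a ha =>
      obtain ⟨i, ha⟩ := ha
      induction m using hM.induction with
      | mem k m hm =>
        rw [hF _ _ (hM.smul_mem i k a m ha hm), hF k m hm, hf i a ha, single_mul_single,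
          map_smul, Algebra.smul_def]
        congr 1
        ring
      | zero => simp
      | add x y hx hy => rw [smul_add, map_add, map_add, mul_add, hx, hy]
    | zero => simp
    | add x y _ _ hx hy => rw [add_smul, map_add, map_add, add_mul, hx, hy]
    | neg x _ hx =>
      rw [neg_smul, map_neg, hx, map_neg]
      exact (neg_mul (f x) (F m)).symm
  obtain ⟨Φ, h1, h2⟩ := exists_symLift f F hFf
  exact ⟨Φ, fun i a ha => (h1 a).trans (hf i a ha), fun k m hm => (h2 m).trans (hF k m hm)⟩

theorem symBigrading_mul {e : ℤ} {i j i' j' : ℕ} {x y : SymmetricAlgebra A M}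
    (hx : x ∈ symBigrading 𝒜 ℳ e i j) (hy : y ∈ symBigrading 𝒜 ℳ e i' j') :
    x * y ∈ symBigrading 𝒜 ℳ e (i + i') (j + j') := by
  have h := Submodule.mul_mem_mul hx hy
  rw [symBigrading, symBigrading, Submodule.span_mul_span] at h
  refine Submodule.span_mono ?_ h
  rintro _ ⟨_, ⟨r, f, hr, hf, rfl⟩, _, ⟨r', f', hr', hf', rfl⟩, rfl⟩
  refine ⟨r * r', Fin.append f f', SetLike.mul_mem_graded hr hr', fun l => ?_, ?_⟩
  · refine Fin.addCases (fun l => ?_) (fun l => ?_) l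
    · rw [Fin.append_left]
      exact hf l
    · rw [Fin.append_right]
      exact hf' l
  · rw [Fin.prod_univ_add]
    simp only [Fin.append_left, Fin.append_right, map_mul]
    exact mul_mul_mul_comm _ _ _ _

omit [GradedAlgebra 𝒜] in
theorem algebraMap_mem_symBigrading (e : ℤ) {i : ℕ} {a : A} (ha : a ∈ 𝒜 i) :
    algebraMap A _ a ∈ symBigrading (M := M) 𝒜 ℳ e i 0 :=
  Submodule.subset_span ⟨a, Fin.elim0, ha, fun l => l.elim0, by simp⟩

theorem ι_mem_symBigrading {e : ℤ} {m : M} (hm : m ∈ ℳ e) :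
    SymmetricAlgebra.ι A M m ∈ symBigrading 𝒜 ℳ e 0 1 :=
  Submodule.subset_span ⟨1, fun _ => m, SetLike.one_mem_graded 𝒜, fun _ => hm, by simp⟩

/-- The elements which are homogeneous with respect to the bigrading. -/
def bihomogeneous (𝒜 : ℕ → Submodule K A) (ℳ : ℤ → Submodule K M) (e : ℤ) :
    Set (SymmetricAlgebra A M) :=
  {s | ∃ i j, s ∈ symBigrading 𝒜 ℳ e i j}

/-- The additive span of the bihomogeneous elements is closed under products and contains A and M_e,
which generate S(M) as a ring because M_e generates M. -/
theorem closure_bihomogeneous {e : ℤ} (hgen : Submodule.span A (ℳ e : Set M) = ⊤) :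
    AddSubgroup.closure (bihomogeneous 𝒜 ℳ e) = ⊤ := by
  have hmul {x y} (hx : x ∈ AddSubgroup.closure (bihomogeneous 𝒜 ℳ e))
      (hy : y ∈ AddSubgroup.closure (bihomogeneous 𝒜 ℳ e)) :
      x * y ∈ AddSubgroup.closure (bihomogeneous 𝒜 ℳ e) := by
    induction hx using AddSubgroup.closure_induction with
    | mem x hx =>
      obtain ⟨i, j, hx⟩ := hx
      induction hy using AddSubgroup.closure_induction with
      | mem y hy =>
        obtain ⟨i', j', hy⟩ := hy
        exact AddSubgroup.subset_closure ⟨_, _, symBigrading_mul hx hy⟩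
      | zero => rw [mul_zero]; exact zero_mem _
      | add a b _ _ ha hb => rw [mul_add]; exact add_mem ha hb
      | neg a _ ha => rw [mul_neg]; exact neg_mem ha
    | zero => rw [zero_mul]; exact zero_mem _
    | add a b _ _ ha hb => rw [add_mul]; exact add_mem ha hb
    | neg a _ ha => rw [neg_mul]; exact neg_mem ha
  have hbase (a : A) : algebraMap A _ a ∈ AddSubgroup.closure (bihomogeneous 𝒜 ℳ e) := by
    have ha : a ∈ AddSubgroup.closure {a : A | ∃ i, a ∈ 𝒜 i} := by
      rw [closure_homogeneous]
      exact AddSubgroup.mem_top a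
    induction ha using AddSubgroup.closure_induction with
    | mem a ha =>
      obtain ⟨i, ha⟩ := ha
      exact AddSubgroup.subset_closure ⟨_, _, algebraMap_mem_symBigrading e ha⟩
    | zero => rw [map_zero]; exact zero_mem _
    | add a b _ _ ha hb => rw [map_add]; exact add_mem ha hb
    | neg a _ ha => rw [map_neg]; exact neg_mem ha
  refine (AddSubgroup.eq_top_iff' _).2 fun s => ?_
  induction s using SymmetricAlgebra.induction with
  | algebraMap a => exact hbase a
  | ι m =>
    have hm : m ∈ Submodule.span A (ℳ e : Set M) := hgen ▸ Submodule.mem_top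
    induction hm using Submodule.span_induction with
    | mem m hm => exact AddSubgroup.subset_closure ⟨_, _, ι_mem_symBigrading hm⟩
    | zero => rw [map_zero]; exact zero_mem _
    | add a b _ _ ha hb => rw [map_add]; exact add_mem ha hb
    | smul a m _ hm =>
      rw [map_smul, Algebra.smul_def]
      exact hmul (hbase a) hm
  | mul a b ha hb => exact hmul ha hb
  | add a b ha hb => exact add_mem ha hb

theorem exists_symGrading (hM : IsGradedModule 𝒜 ℳ) {e : ℤ}
    (hgen : Submodule.span A (ℳ e : Set M) = ⊤) (c d : ℤ) :
    ∃ G : GradingProj ℤ K (SymmetricAlgebra A M),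
      ∀ i j, ∀ s ∈ symBigrading 𝒜 ℳ e i j, s ∈ G.deg (c * i + d * j) := by
  obtain ⟨Φ, hA, hι⟩ := exists_symCoaction hM e c d
  have hK (a : K) : Φ (algebraMap K _ a) = single 0 (algebraMap K _ a) := by
    have := hA 0 _ (SetLike.algebraMap_mem_graded 𝒜 a)
    rwa [Nat.cast_zero, mul_zero, ← algebraMap_sym] at this
  have hΦ {i j : ℕ} {s} (hs : s ∈ symBigrading 𝒜 ℳ e i j) : Φ s = single (c * i + d * j) s := by
    induction hs using Submodule.span_induction with
    | mem s hs =>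
      obtain ⟨r, f, hr, hf, rfl⟩ := hs
      have hprod : ∏ l, (single d (SymmetricAlgebra.ι A M (f l)) :
          AddMonoidAlgebra (SymmetricAlgebra A M) ℤ) =
          single (d * j) (∏ l, SymmetricAlgebra.ι A M (f l)) := by
        rw [AddMonoidAlgebra.prod_single]
        simp only [Finset.sum_const, Finset.card_univ, Fintype.card_fin, nsmul_eq_mul, mul_comm]
      have hfl (l) : Φ (SymmetricAlgebra.ι A M (f l)) = single d (SymmetricAlgebra.ι A M (f l)) := by
        rw [hι e _ (hf l), sub_self, mul_zero, zero_add]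
      rw [map_mul, map_prod, hA i r hr]
      simp only [hfl]
      rw [hprod, single_mul_single]
    | zero => simp
    | add x y _ _ hx hy => rw [map_add, hx, hy, single_add]
    | smul a x _ hx =>
      rw [Algebra.smul_def, map_mul, hK, hx, single_mul_single, zero_add]
  refine ⟨GradingProj.ofCoaction Φ hK (H := bihomogeneous 𝒜 ℳ e)
    (fun s ⟨i, j, hs⟩ => ⟨_, hΦ hs⟩) (closure_bihomogeneous hgen), fun i j s hs => GradingProj.mem_deg_ofCoaction (hΦ hs)⟩

end SymCoaction

/-! ### Bigraded algebras retracting onto their part of second degree zero -/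

section Bigraded

variable {K A S : Type*} [Field K] [CommRing A] [Algebra K A] [CommRing S] [Algebra K S]
  [Algebra A S]

/-- A bigraded `A`-algebra `S` whose part of second degree zero is `A`, with the retraction `π`
killing the elements of positive second degree. Here `T` is the total grading and `Y` the grading
by the second degree. -/
structure BigradedRetract (TA : GradingProj ℤ K A) (T Y : GradingProj ℤ K S)
    (𝒮 : ℕ → ℕ → Submodule K S) (π : S →ₐ[A] A) : Prop where
  mem_T : ∀ {i j s}, s ∈ 𝒮 i j → s ∈ T.deg ((i + j : ℕ) : ℤ)
  mem_Y : ∀ {i j s}, s ∈ 𝒮 i j → s ∈ Y.deg (j : ℤ)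
  closure : AddSubgroup.closure {s | ∃ i j, s ∈ 𝒮 i j} = ⊤
  mul_mem : ∀ {i j i' j' s s'}, s ∈ 𝒮 i j → s' ∈ 𝒮 i' j' → s * s' ∈ 𝒮 (i + i') (j + j')
  base_mem : ∀ {i : ℕ} {a : A}, a ∈ TA.deg (i : ℤ) → algebraMap A S a ∈ 𝒮 i 0
  base_eq : ∀ {i s}, s ∈ 𝒮 i 0 → algebraMap A S (π s) = s
  π_mem : ∀ {i s}, s ∈ 𝒮 i 0 → π s ∈ TA.deg (i : ℤ)
  π_zero : ∀ {i j s}, s ∈ 𝒮 i (j + 1) → π s = 0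

namespace BigradedRetract

variable {TA : GradingProj ℤ K A} {T Y : GradingProj ℤ K S} {𝒮 : ℕ → ℕ → Submodule K S}
  {π : S →ₐ[A] A} (H : BigradedRetract TA T Y 𝒮 π)

include H

theorem induction {p : S → Prop} (mem : ∀ i j, ∀ s ∈ 𝒮 i j, p s) (add : ∀ x y, p x → p y → p (x + y))
    (s : S) : p s := by
  have hs : s ∈ AddSubgroup.closure {s | ∃ i j, s ∈ 𝒮 i j} := H.closure ▸ AddSubgroup.mem_top s
  induction hs using AddSubgroup.closure_induction'' with
  | mem s hs =>
    obtain ⟨i, j, hs⟩ := hs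
    exact mem i j s hs
  | neg_mem s hs =>
    obtain ⟨i, j, hs⟩ := hs
    exact mem i j _ (neg_mem hs)
  | zero => exact mem 0 0 0 (Submodule.zero_mem _)
  | add x y _ _ hx hy => exact add x y hx hy

theorem proj_proj_of_mem {i j : ℕ} {s : S} (hs : s ∈ 𝒮 i j) (k l : ℤ) :
    Y.proj l (T.proj k s) = if k = (i + j : ℕ) ∧ l = j then s else 0 := by
  by_cases hk : k = (i + j : ℕ)
  · by_cases hl : l = j
    · rw [if_pos ⟨hk, hl⟩, hk, GradingProj.mem_deg.1 (H.mem_T hs), hl,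
        GradingProj.mem_deg.1 (H.mem_Y hs)]
    · rw [if_neg fun h => hl h.2, hk, GradingProj.mem_deg.1 (H.mem_T hs),
        GradingProj.proj_of_mem_ne (H.mem_Y hs) hl]
  · rw [if_neg fun h => hk h.1, GradingProj.proj_of_mem_ne (H.mem_T hs) hk, map_zero]

theorem proj_comm (k l : ℤ) (s : S) : T.proj k (Y.proj l s) = Y.proj l (T.proj k s) := by
  induction s using H.induction with
  | mem i j s hs =>
    rw [H.proj_proj_of_mem hs]
    by_cases hl : l = j
    · rw [hl, GradingProj.mem_deg.1 (H.mem_Y hs)]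
      by_cases hk : k = (i + j : ℕ)
      · rw [if_pos ⟨hk, rfl⟩, hk, GradingProj.mem_deg.1 (H.mem_T hs)]
      · rw [if_neg fun h => hk h.1, GradingProj.proj_of_mem_ne (H.mem_T hs) hk]
    · rw [GradingProj.proj_of_mem_ne (H.mem_Y hs) hl, map_zero, if_neg fun h => hl h.2]
  | add x y hx hy => simp only [map_add, hx, hy]

theorem proj_proj_mem (i j : ℕ) (s : S) : Y.proj j (T.proj (i + j : ℕ) s) ∈ 𝒮 i j := by
  induction s using H.induction with
  | mem i' j' s hs =>
    rw [H.proj_proj_of_mem hs]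
    split_ifs with h
    · obtain rfl : j = j' := by omega
      obtain rfl : i = i' := by omega
      exact hs
    · exact Submodule.zero_mem _
  | add x y hx hy =>
    rw [map_add, map_add]
    exact Submodule.add_mem _ hx hy

theorem proj_proj_eq_zero {k l : ℤ} (h : l < 0 ∨ k < l) (s : S) : Y.proj l (T.proj k s) = 0 := by
  induction s using H.induction with
  | mem i j s hs => rw [H.proj_proj_of_mem hs, if_neg (by omega)]
  | add x y hx hy => rw [map_add, map_add, hx, hy, add_zero]

/-- The bigraded pieces are recovered from the two gradings: projecting to both degrees lands in the
piece and fixes s. -/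
theorem mem_of_mem {i j : ℕ} {s : S} (hT : s ∈ T.deg ((i + j : ℕ) : ℤ)) (hY : s ∈ Y.deg (j : ℤ)) :
    s ∈ 𝒮 i j := by
  have := H.proj_proj_mem i j s
  rwa [GradingProj.mem_deg.1 hT, GradingProj.mem_deg.1 hY] at this

theorem eq_zero_of_mem {k l : ℤ} {s : S} (hT : s ∈ T.deg k) (hY : s ∈ Y.deg l)
    (h : l < 0 ∨ k < l) : s = 0 := by
  rw [← H.proj_proj_eq_zero h s, GradingProj.mem_deg.1 hT, GradingProj.mem_deg.1 hY]

theorem isConnected (hTA : TA.IsConnected) [IsScalarTower K A S] : T.IsConnected := by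
  constructor
  · intro k hk s
    induction s using H.induction with
    | mem i j s hs => exact GradingProj.proj_of_mem_ne (H.mem_T hs) (by omega)
    | add x y hx hy => rw [map_add, hx, hy, add_zero]
  · intro s
    induction s using H.induction with
    | mem i j s hs =>
      by_cases h : 0 = i + j
      · obtain rfl : i = 0 := by omega
        obtain rfl : j = 0 := by omega
        obtain ⟨c, hc⟩ := hTA.proj_zero (π s)
        refine ⟨c, ?_⟩
        rw [IsScalarTower.algebraMap_apply K A S, ← hc]
        have h1 := H.π_mem hs
        rw [Nat.cast_zero, GradingProj.mem_deg] at h1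
        rw [h1, H.base_eq hs]
        exact H.mem_T hs
      · exact ⟨0, by rw [map_zero, GradingProj.proj_of_mem_ne (H.mem_T hs) (by omega)]⟩
    | add x y hx hy =>
      obtain ⟨c, hc⟩ := hx
      obtain ⟨d, hd⟩ := hy
      exact ⟨c + d, by rw [map_add, hc, hd, map_add]⟩

theorem deg_eq (m : ℕ) : T.deg (m : ℤ) = ⨆ (i : ℕ) (j : ℕ) (_ : i + j = m), 𝒮 i j := by
  apply le_antisymm
  · intro s hs
    rw [← GradingProj.mem_deg.1 hs]
    clear hs
    induction s using H.induction with
    | mem i j s hs =>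
      by_cases h : m = i + j
      · subst h
        rw [GradingProj.mem_deg.1 (H.mem_T hs)]
        exact Submodule.mem_iSup_of_mem i (Submodule.mem_iSup_of_mem j
          (Submodule.mem_iSup_of_mem rfl hs))
      · rw [GradingProj.proj_of_mem_ne (H.mem_T hs) (by omega)]
        exact Submodule.zero_mem _
    | add x y hx hy =>
      rw [map_add]
      exact Submodule.add_mem _ hx hy
  · refine iSup_le fun i => iSup_le fun j => iSup_le fun h s hs => ?_
    rw [← h]
    exact H.mem_T hs

end BigradedRetract

end Bigraded

/-! ### The symmetric algebra as a bigraded retract -/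

section Symmetric

variable {K A M : Type*} [Field K] [CommRing A] [Algebra K A] [AddCommGroup M] [Module K M]
  [Module A M] [IsScalarTower K A M] {𝒜 : ℕ → Submodule K A} [GradedAlgebra 𝒜]
  {ℳ : ℤ → Submodule K M} {e : ℤ}

theorem algebraMapInv_algebraMap_mul (r : A) {j : ℕ} (f : Fin j → M) :
    SymmetricAlgebra.algebraMapInv (algebraMap A (SymmetricAlgebra A M) r *
      ∏ l, SymmetricAlgebra.ι A M (f l)) = if j = 0 then r else 0 := by
  rw [map_mul, map_prod, SymmetricAlgebra.algebraMap_leftInverse]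
  simp only [SymmetricAlgebra.algebraMapInv_ι]
  cases j with
  | zero => simp
  | succ j => simp

omit [GradedAlgebra 𝒜] in
theorem symBigrading_zero_le {i : ℕ} {s : SymmetricAlgebra A M}
    (hs : s ∈ symBigrading 𝒜 ℳ e i 0) : ∃ a ∈ 𝒜 i, algebraMap A (SymmetricAlgebra A M) a = s := by
  induction hs using Submodule.span_induction with
  | mem s hs =>
    obtain ⟨r, f, hr, -, rfl⟩ := hs
    exact ⟨r, hr, by simp⟩
  | zero => exact ⟨0, Submodule.zero_mem _, map_zero _⟩
  | add x y _ _ hx hy =>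
    obtain ⟨a, ha, rfl⟩ := hx
    obtain ⟨b, hb, rfl⟩ := hy
    exact ⟨a + b, Submodule.add_mem _ ha hb, map_add _ _ _⟩
  | smul c x _ hx =>
    obtain ⟨a, ha, rfl⟩ := hx
    refine ⟨c • a, Submodule.smul_mem _ _ ha, ?_⟩
    rw [Algebra.smul_def, map_mul, ← algebraMap_sym, ← Algebra.smul_def]

omit [GradedAlgebra 𝒜] in
theorem algebraMapInv_symBigrading_succ {i j : ℕ} {s : SymmetricAlgebra A M}
    (hs : s ∈ symBigrading 𝒜 ℳ e i (j + 1)) : SymmetricAlgebra.algebraMapInv s = 0 := by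
  induction hs using Submodule.span_induction with
  | mem s hs =>
    obtain ⟨r, f, hr, -, rfl⟩ := hs
    rw [algebraMapInv_algebraMap_mul, if_neg (Nat.succ_ne_zero j)]
  | zero => exact map_zero _
  | add x y _ _ hx hy => rw [map_add, hx, hy, add_zero]
  | smul c x _ hx => rw [Algebra.smul_def, map_mul, hx, mul_zero]

/-- The symmetric algebra of a graded module generated in a single degree is bigraded. -/
theorem exists_bigradedRetract (hM : IsGradedModule 𝒜 ℳ)
    (hgen : Submodule.span A (ℳ e : Set M) = ⊤) :
    ∃ T Y : GradingProj ℤ K (SymmetricAlgebra A M),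
      BigradedRetract (baseGrading 𝒜) T Y (symBigrading 𝒜 ℳ e) SymmetricAlgebra.algebraMapInv := by
  -- The weights (1, 1) give the total degree, and the weights (0, 1) below give the second degree.
  obtain ⟨T, hT⟩ := exists_symGrading hM hgen 1 1
  obtain ⟨Y, hY⟩ := exists_symGrading hM hgen 0 1
  refine ⟨T, Y, fun {i j s} hs => ?_, fun {i j s} hs => ?_, closure_bihomogeneous hgen,
    symBigrading_mul, fun {i a} ha => ?_, fun {i s} hs => ?_, fun {i s} hs => ?_,
    algebraMapInv_symBigrading_succ⟩
  · simpa using hT i j s hs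
  · simpa using hY i j s hs
  · rw [← baseGrading_deg] at ha
    exact algebraMap_mem_symBigrading e ha
  · obtain ⟨a, -, rfl⟩ := symBigrading_zero_le hs
    rw [SymmetricAlgebra.algebraMap_leftInverse]
  · obtain ⟨a, ha, rfl⟩ := symBigrading_zero_le hs
    rw [SymmetricAlgebra.algebraMap_leftInverse]
    exact mem_baseGrading 𝒜 ha

end Symmetric

/-! ### Coboundaries of families on a double complex -/

section DoubleComplex

variable {S : Type*} [CommRing S] {V V' : Type*} [AddCommGroup V] [Module S V] [AddCommGroup V']
  [Module S V'] {W E : ℕ → Type} [∀ n, Fintype (W n)] [∀ n, Fintype (E n)]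

/-- The first partial coboundary of a family of functions on a double complex of free modules. -/
def bdLeft (L : ∀ n, W (n + 1) → W n → S) (g : ∀ p q, W p → E q → V) :
    ∀ p q, W p → E q → V
  | 0, _, _, _ => 0
  | p + 1, q, w, e => ∑ w', L p w w' • g p q w' e

/-- The second partial coboundary of a family of functions on a double complex of free modules. -/
def bdRight (D : ∀ n, E (n + 1) → E n → S) (g : ∀ p q, W p → E q → V) :
    ∀ p q, W p → E q → V
  | _, 0, _, _ => 0
  | p, q + 1, w, e => ∑ e', D q e e' • g p q w e'

/-- The total coboundary of a family of functions on a double complex of free modules. -/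
def bd (L : ∀ n, W (n + 1) → W n → S) (D : ∀ n, E (n + 1) → E n → S) (g : ∀ p q, W p → E q → V)
    (p q : ℕ) (w : W p) (e : E q) : V :=
  bdLeft L g p q w e + (-1 : S) ^ p • bdRight D g p q w e

variable {L : ∀ n, W (n + 1) → W n → S} {D : ∀ n, E (n + 1) → E n → S}

omit [∀ n, Fintype (E n)] in
theorem bdLeft_succ (g : ∀ p q, W p → E q → V) (p q : ℕ) (w : W (p + 1)) (e : E q) :
    bdLeft L g (p + 1) q w e = ∑ w', L p w w' • g p q w' e := rfl

omit [∀ n, Fintype (W n)] in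
theorem bdRight_succ (g : ∀ p q, W p → E q → V) (p q : ℕ) (w : W p) (e : E (q + 1)) :
    bdRight D g p (q + 1) w e = ∑ e', D q e e' • g p q w e' := rfl

theorem map_bd (φ : V →ₗ[S] V') (g : ∀ p q, W p → E q → V) (p q : ℕ) (w : W p) (e : E q) :
    φ (bd L D g p q w e) = bd L D (fun p q w e => φ (g p q w e)) p q w e := by
  rcases p with _ | p <;> rcases q with _ | q <;> simp [bd, bdLeft, bdRight]

theorem bd_congr {g h : ∀ p q, W p → E q → V} {n : ℕ} (hgh : ∀ p q, p + q = n → g p q = h p q)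
    {p q : ℕ} (hpq : p + q = n + 1) (w : W p) (e : E q) : bd L D g p q w e = bd L D h p q w e := by
  have h1 : bdLeft L g p q w e = bdLeft L h p q w e := by
    rcases p with _ | p
    · rfl
    · simp only [bdLeft, hgh p q (by omega)]
  have h2 : bdRight D g p q w e = bdRight D h p q w e := by
    rcases q with _ | q
    · rfl
    · simp only [bdRight, hgh p q (by omega)]
  rw [bd, bd, h1, h2]

omit [∀ n, Fintype (E n)] in
theorem bdLeft_bdLeft (hL : ∀ n k l, ∑ j, L (n + 1) k j * L n j l = 0)
    (g : ∀ p q, W p → E q → V) (p q : ℕ) (w : W p) (e : E q) :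
    bdLeft L (bdLeft L g) p q w e = 0 := by
  rcases p with _ | _ | p
  · rfl
  · simp [bdLeft]
  · simp only [bdLeft, Finset.smul_sum, smul_smul]
    rw [Finset.sum_comm]
    simp only [← Finset.sum_smul, hL, zero_smul, Finset.sum_const_zero]

omit [∀ n, Fintype (W n)] in
theorem bdRight_bdRight (hD : ∀ n k l, ∑ j, D (n + 1) k j * D n j l = 0)
    (g : ∀ p q, W p → E q → V) (p q : ℕ) (w : W p) (e : E q) :
    bdRight D (bdRight D g) p q w e = 0 := by
  rcases q with _ | _ | q
  · rfl
  · simp [bdRight]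
  · simp only [bdRight, Finset.smul_sum, smul_smul]
    rw [Finset.sum_comm]
    simp only [← Finset.sum_smul, hD, zero_smul, Finset.sum_const_zero]

/-- The two partial coboundaries square to zero and commute; the sign (-1)^p makes the mixed terms
cancel. -/
theorem bd_bd (hL : ∀ n k l, ∑ j, L (n + 1) k j * L n j l = 0)
    (hD : ∀ n k l, ∑ j, D (n + 1) k j * D n j l = 0)
    (g : ∀ p q, W p → E q → V) (p q : ℕ) (w : W p) (e : E q) :
    bd L D (bd L D g) p q w e = 0 := by
  have h1 : bdLeft L (bd L D g) p q w e = -((-1 : S) ^ p • bdLeft L (bdRight D g) p q w e) := by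
    have := bdLeft_bdLeft hL g p q w e
    rcases p with _ | p
    · simp [bdLeft]
    · rw [bdLeft_succ] at this
      simp only [bdLeft_succ _ p, bd, smul_add, Finset.sum_add_distrib, this, zero_add, smul_comm _ ((-1 : S) ^ p),
        ← Finset.smul_sum, pow_succ, mul_neg, mul_one, neg_smul, neg_neg]
  have h2 : bdRight D (bd L D g) p q w e = bdRight D (bdLeft L g) p q w e := by
    have := bdRight_bdRight hD g p q w e
    rcases q with _ | q
    · rfl
    · rw [bdRight_succ] at this
      simp only [bdRight_succ _ _ q, bd, smul_add, Finset.sum_add_distrib, smul_comm _ ((-1 : S) ^ p),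
        ← Finset.smul_sum, this, smul_zero, add_zero]
  have h3 : bdLeft L (bdRight D g) p q w e = bdRight D (bdLeft L g) p q w e := by
    rcases p with _ | p
    · rcases q with _ | q <;> simp [bdLeft, bdRight]
    · rcases q with _ | q
      · simp [bdLeft, bdRight]
      · simp only [bdLeft, bdRight, Finset.smul_sum]
        rw [Finset.sum_comm]
        exact Finset.sum_congr rfl fun _ _ => Finset.sum_congr rfl fun _ _ => smul_comm _ _ _
  rw [bd, h1, h2, h3, neg_add_cancel]

end DoubleComplex

/-! ### The chain map L ⊗ F → F extending the identity -/

section Comparison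

variable {K S : Type*} [Field K] [CommRing S] [Algebra K S] {T : GradingProj ℤ K S}
  {W E : ℕ → Type} [∀ n, Fintype (W n)] [∀ n, Fintype (E n)]

theorem bd_mem_deg {L : ∀ n, W (n + 1) → W n → S} {D : ∀ n, E (n + 1) → E n → S}
    (hL : ∀ n k l, L n k l ∈ T.deg 1) (hD : ∀ n k l, D n k l ∈ T.deg 1)
    {n : ℕ} {g : ∀ p q, W p → E q → E n → S} (hg : ∀ p q w e l, g p q w e l ∈ T.deg 0)
    (p q : ℕ) (w : W p) (e : E q) (l : E n) : bd L D g p q w e l ∈ T.deg 1 := by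
  have hmul {x y : S} (hx : x ∈ T.deg 1) (hy : y ∈ T.deg 0) : x * y ∈ T.deg 1 := by
    simpa using GradingProj.mul_mem hx hy
  have hneg {x : S} (hx : x ∈ T.deg 1) (m : ℕ) : (-1 : S) ^ m * x ∈ T.deg 1 := by
    rcases neg_one_pow_eq_or S m with h | h <;> rw [h]
    · rwa [one_mul]
    · rw [neg_one_mul]
      exact neg_mem hx
  refine Submodule.add_mem _ ?_ (hneg ?_ p)
  · rcases p with _ | p
    · exact Submodule.zero_mem _
    · simp only [bdLeft, Finset.sum_apply, Pi.smul_apply, smul_eq_mul]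
      exact Submodule.sum_mem _ fun w' _ => hmul (hL _ _ _) (hg _ _ _ _ _)
  · rcases q with _ | q
    · exact Submodule.zero_mem _
    · simp only [bdRight, Finset.sum_apply, Pi.smul_apply, smul_eq_mul]
      exact Submodule.sum_mem _ fun w' _ => hmul (hD _ _ _) (hg _ _ _ _ _)

variable [∀ n, DecidableEq (E n)]

/-- The component in degree `n` of a chain map `L ⊗ F → F` of degree zero extending the identity
of `F`, subject to the condition that it can be extended to degree `n + 1`. -/
structure ComparisonStep (T : GradingProj ℤ K S) (L : ∀ n, W (n + 1) → W n → S)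
    (D : ∀ n, E (n + 1) → E n → S) (n : ℕ) where
  map : ∀ p q, W p → E q → E n → S
  deg_zero : ∀ p q w e l, map p q w e l ∈ T.deg 0
  map_zero : ∀ w e, map 0 n w e = Pi.single e 1
  isCyc : ∀ p q, p + q = n + 1 → ∀ w e, IsCyc D n (bd L D map p q w e)

/-- The usual lifting of chain maps from a free complex to an acyclic one. Linearity of both
complexes puts the obstruction in internal degree one, so exactness supplies a lift with entries of
degree zero. -/
theorem ComparisonStep.exists_succ {L : ∀ n, W (n + 1) → W n → S}
    {D : ∀ n, E (n + 1) → E n → S} (hL : ∀ n k l, L n k l ∈ T.deg 1)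
    (hD : ∀ n k l, D n k l ∈ T.deg 1) (hLL : ∀ n k l, ∑ j, L (n + 1) k j * L n j l = 0)
    (hDD : ∀ n k l, ∑ j, D (n + 1) k j * D n j l = 0)
    (hK : Kos D (fun i : ℕ => T.deg (i : ℤ))) {n : ℕ} (c : ComparisonStep T L D n) :
    ∃ c' : ComparisonStep T L D (n + 1), ∀ p q, p + q = n + 1 → ∀ w e,
      act (D n) (c'.map p q w e) = bd L D c.map p q w e := by
  classical
  have hex (p q : ℕ) (h : p + q = n + 1) (w : W p) (e : E q) : ∃ y : E (n + 1) → S,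
      (∀ k, y k ∈ T.deg ((0 : ℕ) : ℤ)) ∧ act (D n) y = bd L D c.map p q w e :=
    hK n 0 _ (fun k => by simpa using bd_mem_deg hL hD c.deg_zero p q w e k) (c.isCyc p q h w e)
  choose y hy hyc using hex
  -- For p = 0 the identity is prescribed; comparing dependent pairs avoids a transport along q = n
  -- + 1. Values off the line p + q = n + 1 are never used.
  let m : ∀ p q, W p → E q → E (n + 1) → S := fun p q w e =>
    if p = 0 then fun l => if (⟨q, e⟩ : Σ q, E q) = ⟨n + 1, l⟩ then 1 else 0
    else if h : p + q = n + 1 then y p q h w e else 0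
  have hm0 (w : W 0) (e : E (n + 1)) : m 0 (n + 1) w e = Pi.single e 1 := by
    funext l
    simp [m, Pi.single_apply, eq_comm]
  have hrel (p q : ℕ) (h : p + q = n + 1) (w : W p) (e : E q) :
      act (D n) (m p q w e) = bd L D c.map p q w e := by
    rcases p with _ | p
    · obtain rfl : q = n + 1 := by omega
      rw [hm0]
      funext l
      simp only [bd, bdLeft, bdRight, c.map_zero, act_apply]
      simp [Pi.single_apply]
    · have : m (p + 1) q w e = y (p + 1) q h w e := by
        simp [m, h]
      rw [this, hyc]
  refine ⟨⟨m, fun p q w e l => ?_, hm0, fun p q h w e => ?_⟩, hrel⟩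
  · by_cases hp : p = 0
    · simp only [m, if_pos hp]
      split_ifs
      · exact GradingProj.one_mem
      · exact Submodule.zero_mem _
    · by_cases h : p + q = n + 1
      · simp only [m, if_neg hp, dif_pos h]
        exact hy _ _ h w e l
      · simp only [m, if_neg hp, dif_neg h]
        exact Submodule.zero_mem _
  · change act (D n) _ = 0
    rw [map_bd, bd_congr (h := bd L D c.map) (fun p q h => funext fun w => funext fun e =>
      hrel p q h w e) h, bd_bd hLL hDD]

theorem exists_comparison {L : ∀ n, W (n + 1) → W n → S}
    {D : ∀ n, E (n + 1) → E n → S} (hL : ∀ n k l, L n k l ∈ T.deg 1)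
    (hD : ∀ n k l, D n k l ∈ T.deg 1) (hLL : ∀ n k l, ∑ j, L (n + 1) k j * L n j l = 0)
    (hDD : ∀ n k l, ∑ j, D (n + 1) k j * D n j l = 0)
    (hK : Kos D (fun i : ℕ => T.deg (i : ℤ))) :
    ∃ μ : ∀ n p q, W p → E q → E n → S, (∀ n p q w e l, μ n p q w e l ∈ T.deg 0) ∧
      (∀ n w e, μ n 0 n w e = Pi.single e 1) ∧
      ∀ n p q, p + q = n + 1 → ∀ w e,
        act (D n) (μ (n + 1) p q w e) = bd L D (μ n) p q w e := by
  let c₀ : ComparisonStep T L D 0 :=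
    { map := fun p q w e l => if (⟨q, e⟩ : Σ q, E q) = ⟨0, l⟩ then 1 else 0
      deg_zero := fun p q w e l => by
        split_ifs
        · exact GradingProj.one_mem
        · exact Submodule.zero_mem _
      map_zero := fun w e => by
        funext l
        simp [Pi.single_apply, eq_comm]
      isCyc := fun _ _ _ _ _ => True.intro }
  choose next hnext using fun n (c : ComparisonStep T L D n) => c.exists_succ hL hD hLL hDD hK
  let c : ∀ n, ComparisonStep T L D n := fun n => Nat.rec c₀ next n
  exact ⟨fun n => (c n).map, fun n => (c n).deg_zero, fun n => (c n).map_zero,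
    fun n => hnext n (c n)⟩

end Comparison

/-! ### Transferring exactness from L to F -/

section Transfer

variable {K A : Type*} [Field K] [CommRing A]
  {W E : ℕ → Type} [∀ n, Fintype (W n)] [∀ n, Fintype (E n)] [∀ n, DecidableEq (E n)]
  {N : Type*} [AddCommGroup N] [Module K N] [Module A N]

/-- Given a chain map `L ⊗ F → F` extending the identity, exactness of `N ⊗ L` in positive degrees
implies exactness of `N ⊗ F` in positive degrees. -/
theorem Kos.transfer {L : ∀ n, W (n + 1) → W n → A} {D : ∀ n, E (n + 1) → E n → A}
    (hDD : ∀ n k l, ∑ j, D (n + 1) k j * D n j l = 0) [Unique (W 0)]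
    {μ : ∀ n p q, W p → E q → E n → A} {𝒩 : ℕ → Submodule K N}
    (hμ𝒩 : ∀ n p q w e l i, ∀ x ∈ 𝒩 i, μ n p q w e l • x ∈ 𝒩 i)
    (hD𝒩 : ∀ n k l i, ∀ x ∈ 𝒩 i, D n k l • x ∈ 𝒩 (i + 1))
    (hμ : ∀ n w e, μ n 0 n w e = Pi.single e 1)
    (hbd : ∀ n p q, p + q = n + 1 → ∀ w e,
        act (D n) (μ (n + 1) p q w e) = bd L D (μ n) p q w e)
    (hK : Kos L 𝒩) : Kos D 𝒩 := by
  -- The chain map identity applied to a lift u of v along L: the boundary of μ(u) is μ(v) up to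
  -- sign times μ of the boundary of u in the F direction.
  have step (p q n : ℕ) (hpq : p + q = n) (v : W p → E q → N) (u : E q → W (p + 1) → N)
      (huv : ∀ e, act (L p) (u e) = fun w => v w e) (l : E n) :
      act (D n) (fun k => ∑ w, ∑ e, μ (n + 1) (p + 1) q w e k • u e w) l =
        ∑ w, ∑ e, μ n p q w e l • v w e +
          (-1 : A) ^ (p + 1) • ∑ w, ∑ e, bdRight D (μ n) (p + 1) q w e l • u e w := by
    have h1 : act (D n) (fun k => ∑ w, ∑ e, μ (n + 1) (p + 1) q w e k • u e w) l =
        ∑ w, ∑ e, act (D n) (μ (n + 1) (p + 1) q w e) l • u e w := by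
      simp only [act_apply, Finset.smul_sum, Finset.sum_smul, smul_smul, smul_eq_mul]
      rw [Finset.sum_comm]
      refine Finset.sum_congr rfl fun w _ => ?_
      rw [Finset.sum_comm]
    have h2 : ∑ w, ∑ e, (∑ w', L p w w' * μ n p q w' e l) • u e w =
        ∑ w, ∑ e, μ n p q w e l • v w e := by
      rw [Finset.sum_comm, Finset.sum_comm (s := (Finset.univ : Finset (W p)))]
      refine Finset.sum_congr rfl fun e _ => ?_
      simp only [Finset.sum_smul]
      rw [Finset.sum_comm]
      refine Finset.sum_congr rfl fun w' _ => ?_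
      rw [← congrFun (huv e) w', act_apply, Finset.smul_sum]
      refine Finset.sum_congr rfl fun w _ => ?_
      rw [smul_smul, mul_comm]
    rw [h1, ← h2, Finset.smul_sum, ← Finset.sum_add_distrib]
    refine Finset.sum_congr rfl fun w _ => ?_
    rw [Finset.smul_sum, ← Finset.sum_add_distrib]
    refine Finset.sum_congr rfl fun e _ => ?_
    rw [hbd n (p + 1) q (by omega), bd, bdLeft_succ, Pi.add_apply, add_smul, Finset.sum_apply,
      Pi.smul_apply, smul_assoc]
    rfl
  -- Zigzag: if v is a cycle in both directions, then μ(v) is a boundary. Lift v to u along L and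
  -- replace v by the F-boundary of u. This is again a cycle in both directions, has the same module
  -- degree i + 1, and sits at (p + 1, q - 1). At q = 0 there is no F-boundary left.
  have key (i q : ℕ) : ∀ p n, p + q = n → ∀ v : W p → E q → N, (∀ w e, v w e ∈ 𝒩 (i + 1)) →
      (∀ e, IsCyc L p fun w => v w e) → (∀ w, IsCyc D q (v w)) →
      ∃ y : E (n + 1) → N, (∀ k, y k ∈ 𝒩 i) ∧
        ∀ l, act (D n) y l = ∑ w, ∑ e, μ n p q w e l • v w e := by
    induction q with
    | zero =>
      intro p n hpq v hv hvL _
      choose u hu huv using fun e => hK p i (fun w => v w e) (fun w => hv w e) (hvL e)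
      refine ⟨fun k => ∑ w, ∑ e, μ (n + 1) (p + 1) 0 w e k • u e w, fun k =>
        Submodule.sum_mem _ fun w _ => Submodule.sum_mem _ fun e _ => hμ𝒩 _ _ _ _ _ _ _ _ (hu e w),
        fun l => ?_⟩
      rw [step p 0 n hpq v u huv]
      simp [bdRight]
    | succ q ih =>
      intro p n hpq v hv hvL hvD
      choose u hu huv using fun e => hK p i (fun w => v w e) (fun w => hv w e) (hvL e)
      let v' : W (p + 1) → E q → N := fun w => act (D q) fun e => u e w
      obtain ⟨y, hy, hyv⟩ := ih (p + 1) n (by omega) v'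
        (fun w e => Submodule.sum_mem _ fun k _ => hD𝒩 _ _ _ _ _ (hu k w)) (fun e' => by
          change act (L p) _ = 0
          funext w'
          have h0 : act (D q) (v w') e' = 0 := congrFun (hvD w' : act (D q) (v w') = 0) e'
          rw [Pi.zero_apply, ← h0, act_apply, act_apply]
          simp only [v', act_apply, Finset.smul_sum]
          rw [Finset.sum_comm]
          refine Finset.sum_congr rfl fun e _ => ?_
          rw [← congrFun (huv e) w', act_apply, Finset.smul_sum]
          exact Finset.sum_congr rfl fun w _ => smul_comm _ _ _) (fun w => by
          cases q with
          | zero => exact True.intro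
          | succ q =>
            change act (D q) (act (D (q + 1)) _) = 0
            rw [act_act]
            simp only [hDD]
            exact act_zero_matrix _)
      have h3 (l : E n) : ∑ w, ∑ e, bdRight D (μ n) (p + 1) (q + 1) w e l • u e w =
          ∑ w, ∑ e, μ n (p + 1) q w e l • v' w e := by
        refine Finset.sum_congr rfl fun w _ => ?_
        simp only [bdRight_succ, Finset.sum_apply, Finset.sum_smul, v', act_apply, Finset.smul_sum]
        rw [Finset.sum_comm]
        refine Finset.sum_congr rfl fun e' _ => Finset.sum_congr rfl fun e _ => ?_
        rw [Pi.smul_apply, smul_smul, smul_eq_mul, mul_comm]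
      have h4 (k : E (n + 1)) :
          ∑ w, ∑ e, μ (n + 1) (p + 1) (q + 1) w e k • u e w ∈ 𝒩 i :=
        Submodule.sum_mem _ fun w _ => Submodule.sum_mem _ fun e _ => hμ𝒩 _ _ _ _ _ _ _ _ (hu e w)
      refine ⟨(fun k => ∑ w, ∑ e, μ (n + 1) (p + 1) (q + 1) w e k • u e w) -
        (-1 : A) ^ (p + 1) • y, fun k => ?_, fun l => ?_⟩
      · rcases neg_one_pow_eq_or A (p + 1) with h | h <;>
          rw [h, Pi.sub_apply, Pi.smul_apply]
        · rw [one_smul]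
          exact Submodule.sub_mem _ (h4 k) (hy k)
        · rw [neg_one_smul]
          exact Submodule.sub_mem _ (h4 k) (Submodule.neg_mem _ (hy k))
      · rw [map_sub, map_smul, Pi.sub_apply, Pi.smul_apply, step p (q + 1) n hpq v u huv, hyv, h3,
          add_sub_cancel_right]
  intro n i x hx hc
  -- The zigzag starts at p = 0, where every element is an L-cycle and μ is the identity.
  obtain ⟨y, hy, hyx⟩ := key i n 0 n (zero_add n) (fun _ => x) (fun _ => hx) (fun _ => True.intro)
    (fun _ => hc)
  refine ⟨y, hy, ?_⟩
  funext l
  rw [hyx]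
  simp [hμ, Pi.single_apply, ite_smul]

end Transfer

/-! ### Bigraded resolutions, their reduction to A and the strand b = 0 -/

section

variable {K A S : Type*} [Field K] [CommRing A] [Algebra K A] [CommRing S] [Algebra K S]
  [Algebra A S]

theorem act_proj_fine {ι B : Type*} [AddCommGroup ι] [CommRing B] [Algebra K B]
    {G : GradingProj ι K B} {m n : Type} [Fintype m] {α : m → ι} {β : n → ι} {D : m → n → B}
    (hD : ∀ k l, D k l ∈ G.deg (α k - β l)) (y : m → B) (k : ι) :
    act D (fun i => G.proj (k - α i) (y i)) = fun l => G.proj (k - β l) (act D y l) := by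
  have h := linearCombination_proj G hD y k
  have h' (z : m → B) : Fintype.linearCombination B D z = act D z := by
    funext l
    simp [Fintype.linearCombination_apply, act_apply, mul_comm]
  rwa [h', h'] at h

/-- A bigraded linear complex of free modules over a bigraded algebra, resolving the residue class
field. The basis element `k` in homological degree `n` has bidegree `(n - b n k, b n k)`. -/
structure BigradedComplex (T : GradingProj ℤ K S) (𝒮 : ℕ → ℕ → Submodule K S) where
  E : ℕ → Type
  fin : ∀ n, Fintype (E n)
  dec : ∀ n, DecidableEq (E n)
  b : ∀ n, E n → ℕ
  D : ∀ n, E (n + 1) → E n → S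
  unique_zero : Nonempty (Unique (E 0))
  b_zero : ∀ e, b 0 e = 0
  D_same : ∀ n k l, b (n + 1) k = b n l → D n k l ∈ 𝒮 1 0
  D_succ : ∀ n k l, b (n + 1) k = b n l + 1 → D n k l ∈ 𝒮 0 1
  D_other : ∀ n k l, b (n + 1) k ≠ b n l → b (n + 1) k ≠ b n l + 1 → D n k l = 0
  D_comp : ∀ n k l, ∑ j, D (n + 1) k j * D n j l = 0
  exact : Kos D (fun i : ℕ => T.deg (i : ℤ))

attribute [instance] BigradedComplex.fin BigradedComplex.dec

variable {TA : GradingProj ℤ K A} {T Y : GradingProj ℤ K S} {𝒮 : ℕ → ℕ → Submodule K S}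
  {π : S →ₐ[A] A}

theorem act_mem {m n : Type} [Fintype m] {D : m → n → S} {y : m → S} {P : Submodule K S} (j : n)
    (h : ∀ k, D k j * y k ∈ P) : act D y j ∈ P :=
  Submodule.sum_mem _ fun k _ => h k

theorem linearCombination_eq_act {m n : Type} [Fintype m] (D : m → n → S) (z : m → S) :
    Fintype.linearCombination S D z = act D z := by
  funext l
  simp [Fintype.linearCombination_apply, act_apply, mul_comm]

theorem BigradedRetract.proj_π (H : BigradedRetract TA T Y 𝒮 π) (k : ℤ) (s : S) :
    TA.proj k (π s) = π (T.proj k s) := by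
  induction s using H.induction with
  | mem i j s hs =>
    have hT := H.mem_T hs
    rcases j with _ | j
    · rw [add_zero] at hT
      by_cases h : k = i
      · rw [h, GradingProj.mem_deg.1 hT, GradingProj.mem_deg.1 (H.π_mem hs)]
      · rw [GradingProj.proj_of_mem_ne hT h, map_zero, GradingProj.proj_of_mem_ne (H.π_mem hs) h]
    · rw [H.π_zero hs, map_zero]
      by_cases h : k = (i + (j + 1) : ℕ)
      · rw [h, GradingProj.mem_deg.1 hT, H.π_zero hs]
      · rw [GradingProj.proj_of_mem_ne hT h, map_zero]
  | add x y hx hy => simp only [map_add, hx, hy]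

theorem map_bd_apply {R R' : Type*} [CommRing R] [CommRing R'] (f : R →+* R')
    {W E : ℕ → Type} [∀ n, Fintype (W n)] [∀ n, Fintype (E n)]
    (L : ∀ n, W (n + 1) → W n → R) (D : ∀ n, E (n + 1) → E n → R) {n : ℕ}
    (g : ∀ p q, W p → E q → E n → R) (p q : ℕ) (w : W p) (e : E q) (l : E n) :
    f (bd L D g p q w e l) = bd (fun n k l => f (L n k l)) (fun n k l => f (D n k l))
      (fun p q w e l => f (g p q w e l)) p q w e l := by
  rcases p with _ | p <;> rcases q with _ | q <;> simp [bd, bdLeft, bdRight]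

/-- A Koszul bigraded algebra has a bigraded linear resolution of its residue class field. -/
theorem BigradedRetract.exists_bigradedComplex (H : BigradedRetract TA T Y 𝒮 π)
    (hT : T.IsConnected) (C : KoszulComplex T) {𝒯 : ℕ → Submodule K S}
    (h𝒯 : ∀ i : ℕ, 𝒯 i = T.deg (i : ℤ)) : Nonempty (BigradedComplex T 𝒮) := by
  -- The given complex only certifies linearity. The resolution is rebuilt from the irrelevant
  -- ideal, with generators also homogeneous for the second degree.
  let s := residueStage C Y hT H.proj_comm h𝒯
  let E : ℕ → Type := fun n => Fin (s.seq hT H.proj_comm n).t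
  let β : ∀ n, E n → ℤ := fun n => (s.seq hT H.proj_comm n).β
  let D : ∀ n, E (n + 1) → E n → S := s.mat hT H.proj_comm
  have hDT (n k l) : D n k l ∈ T.deg 1 := s.mat_mem_deg hT H.proj_comm n k l
  have hDY (n k l) : D n k l ∈ Y.deg (β (n + 1) k - β n l) := s.mat_mem_fine hT H.proj_comm n k l
  -- An entry has total degree one, so it vanishes unless its second degree is 0 or 1.
  have hzero (n k l) (h0 : β (n + 1) k ≠ β n l) (h1 : β (n + 1) k ≠ β n l + 1) : D n k l = 0 := by
    rcases lt_or_gt_of_ne h0 with h | h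
    · exact H.eq_zero_of_mem (hDT n k l) (hDY n k l) (Or.inl (by omega))
    · exact H.eq_zero_of_mem (hDT n k l) (hDY n k l) (Or.inr (by omega))
  have hβ0 (e : E 0) : β 0 e = 0 := rfl
  -- By minimality each generator has a nonzero entry, so its second degree is at least that of some
  -- earlier generator.
  have hβ (n) (e : E n) : 0 ≤ β n e := by
    induction n with
    | zero => exact (hβ0 e).ge
    | succ n ih =>
      obtain ⟨l, hl⟩ := Function.ne_iff.1 (s.mat_ne_zero hT H.proj_comm n e)
      by_contra hneg
      have := ih l
      exact hl (hzero n e l (by omega) (by omega))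
  have hZ (n) (z : E n → S) : z ∈ (s.seq hT H.proj_comm n).Z ↔ ∃ y, act (D n) y = z := by
    rw [← s.range_mat hT H.proj_comm n, LinearMap.mem_range]
    exact exists_congr fun y => by rw [linearCombination_eq_act]
  have hker (n) (z : E (n + 1) → S) :
      z ∈ (s.seq hT H.proj_comm (n + 1)).Z ↔ act (D n) z = 0 := by
    rw [← s.ker_mat hT H.proj_comm n, LinearMap.mem_ker, linearCombination_eq_act]
  refine ⟨⟨E, fun n => inferInstance, fun n => inferInstance, fun n k => (β n k).toNat, D,
    ⟨(inferInstance : Unique (Fin 1))⟩, fun e => by rw [hβ0]; rfl, fun n k l h => ?_,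
    fun n k l h => ?_, fun n k l h h' => ?_, fun n k l => ?_, ?_⟩⟩
  · have h1 := hβ (n + 1) k
    have h2 := hβ n l
    refine H.mem_of_mem (by simpa using hDT n k l) ?_
    have := hDY n k l
    rwa [show β (n + 1) k - β n l = ((0 : ℕ) : ℤ) by omega] at this
  · have h1 := hβ (n + 1) k
    have h2 := hβ n l
    refine H.mem_of_mem (by simpa using hDT n k l) ?_
    have := hDY n k l
    rwa [show β (n + 1) k - β n l = ((1 : ℕ) : ℤ) by omega] at this
  · have h1 := hβ (n + 1) k
    have h2 := hβ n l
    exact hzero n k l (by omega) (by omega)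
  · have h1 := (hker n (D (n + 1) k)).1 (((s.seq hT H.proj_comm (n + 1)).gens hT
      H.proj_comm).M_mem k).1
    exact (Finset.sum_congr rfl fun j _ => mul_comm _ _).trans (congrFun h1 l)
  · intro n i x hx hc
    have hxZ : x ∈ (s.seq hT H.proj_comm n).Z := by
      cases n with
      | zero =>
        change (irrelevantIdeal 𝒯).mkQ (x (0 : Fin 1)) = 0
        rw [Submodule.mkQ_apply, Submodule.Quotient.mk_eq_zero, mem_irrelevantIdeal_iff hT h𝒯]
        exact GradingProj.proj_of_mem_ne (hx (0 : Fin 1)) (by omega)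
      | succ n => exact (hker n x).2 hc
    obtain ⟨y, hy⟩ := (hZ n x).1 hxZ
    refine ⟨fun k => T.proj i (y k), fun k => GradingProj.proj_mem _ _, ?_⟩
    rw [act_proj (hDT n), hy]
    funext k
    exact_mod_cast hx k

namespace BigradedComplex

variable (F : BigradedComplex T 𝒮)

/-- The basis elements of second degree zero. -/
abbrev W (n : ℕ) : Type := {e : F.E n // F.b n e = 0}

/-- The matrices of the complex, reduced to the base algebra. -/
def baseD (π : S →ₐ[A] A) (n : ℕ) (k : F.E (n + 1)) (l : F.E n) : A := π (F.D n k l)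

/-- The matrices of the strand of second degree zero. -/
def strandD (π : S →ₐ[A] A) (n : ℕ) (k : F.W (n + 1)) (l : F.W n) : A := F.baseD π n k l

noncomputable instance : Unique (F.E 0) := F.unique_zero.some

noncomputable instance : Unique (F.W 0) where
  default := ⟨default, F.b_zero _⟩
  uniq _ := Subtype.ext (Subsingleton.elim _ _)

variable {F}

theorem sum_W {n : ℕ} {N : Type*} [AddCommMonoid N] (f : F.E n → N) (hf : ∀ e, F.b n e ≠ 0 → f e = 0) :
    ∑ w : F.W n, f w = ∑ e, f e :=
  Fintype.sum_of_injective Subtype.val Subtype.val_injective _ _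
    (fun e he => hf e fun h => he ⟨⟨e, h⟩, rfl⟩) fun _ => rfl

section

variable (H : BigradedRetract TA T Y 𝒮 π)

include H

theorem baseD_eq_zero {n : ℕ} {k : F.E (n + 1)} {l : F.E n} (h : F.b (n + 1) k ≠ F.b n l) :
    F.baseD π n k l = 0 := by
  by_cases h' : F.b (n + 1) k = F.b n l + 1
  · exact H.π_zero (F.D_succ n k l h')
  · rw [baseD, F.D_other n k l h h', map_zero]

theorem baseD_smul {n : ℕ} {k : F.E (n + 1)} {l : F.E n} (h : F.b (n + 1) k = F.b n l) (s : S) :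
    F.baseD π n k l • s = F.D n k l * s := by
  rw [Algebra.smul_def, baseD, H.base_eq (F.D_same n k l h)]

theorem baseD_mem (n : ℕ) (k : F.E (n + 1)) (l : F.E n) : F.baseD π n k l ∈ TA.deg 1 := by
  by_cases h : F.b (n + 1) k = F.b n l
  · exact_mod_cast H.π_mem (F.D_same n k l h)
  · rw [baseD_eq_zero H h]
    exact Submodule.zero_mem _

theorem D_mem (n : ℕ) (k : F.E (n + 1)) (l : F.E n) : F.D n k l ∈ T.deg 1 := by
  by_cases h : F.b (n + 1) k = F.b n l
  · exact_mod_cast H.mem_T (F.D_same n k l h)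
  · by_cases h' : F.b (n + 1) k = F.b n l + 1
    · exact_mod_cast H.mem_T (F.D_succ n k l h')
    · rw [F.D_other n k l h h']
      exact Submodule.zero_mem _

theorem D_mem_Y (n : ℕ) (k : F.E (n + 1)) (l : F.E n) :
    F.D n k l ∈ Y.deg ((F.b (n + 1) k : ℤ) - F.b n l) := by
  by_cases h : F.b (n + 1) k = F.b n l
  · have := H.mem_Y (F.D_same n k l h)
    rwa [h, sub_self]
  · by_cases h' : F.b (n + 1) k = F.b n l + 1
    · have := H.mem_Y (F.D_succ n k l h')
      rw [h']
      convert this using 2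
      push_cast
      ring
    · rw [F.D_other n k l h h']
      exact Submodule.zero_mem _

omit H [Algebra K A] in
theorem baseD_comp (n : ℕ) (k : F.E (n + 1 + 1)) (l : F.E n) :
    ∑ j, F.baseD π (n + 1) k j * F.baseD π n j l = 0 := by
  simp only [baseD, ← map_mul, ← map_sum, F.D_comp, map_zero]

theorem strandD_comp (n : ℕ) (k : F.W (n + 1 + 1)) (l : F.W n) :
    ∑ j, F.strandD π (n + 1) k j * F.strandD π n j l = 0 := by
  rw [← F.baseD_comp (π := π) n k l]
  refine sum_W (fun j => F.baseD π (n + 1) k j * F.baseD π n j l) fun e he => ?_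
  rw [baseD_eq_zero H (by rw [k.2]; exact he.symm), zero_mul]

-- The differential never raises b, so a path starting at b = 0 stays there: the strand is a complex
-- over S, before any reduction to A.
omit [CommRing A] [Algebra K A] [Algebra A S] H in
theorem strandD_comp_D (n : ℕ) (k : F.W (n + 1 + 1)) (l : F.W n) :
    ∑ j : F.W (n + 1), F.D (n + 1) k j * F.D n j l = 0 := by
  rw [← F.D_comp n k l]
  refine sum_W (fun j => F.D (n + 1) k j * F.D n j l) fun e he => ?_
  rw [F.D_other _ _ _ (by rw [k.2]; exact he.symm) (by rw [k.2]; omega), zero_mul]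

/-- If the component of `S` of second degree `j` is a Koszul module over `A`, then its tensor
product with the whole reduced complex is exact in positive degrees. -/
theorem kos_baseD {j : ℕ} (hK : Kos (F.strandD π) fun i => 𝒮 i j) :
    Kos (F.baseD π) fun i => 𝒮 i j := by
  -- The comparison map must be built over S, where F is exact; the reduced complex need not be. Its
  -- image under π still satisfies the chain map identities.
  obtain ⟨μ, hμ0, hμ1, hμ2⟩ := exists_comparison (T := T) (W := F.W) (E := F.E)
    (L := fun n k l => F.D n k l) (D := F.D) (fun n k l => F.D_mem H n k l) (F.D_mem H)
    F.strandD_comp_D F.D_comp F.exact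
  have hcoe (n p q w e) (l : F.E n) : π (μ n p q w e l) ∈ TA.deg ((0 : ℕ) : ℤ) := by
    rw [GradingProj.mem_deg, H.proj_π, Nat.cast_zero, GradingProj.mem_deg.1 (hμ0 n p q w e l)]
  refine Kos.transfer (L := F.strandD π) (D := F.baseD π) F.baseD_comp
    (μ := fun n p q w e l => π (μ n p q w e l)) (fun n p q w e l i x hx => ?_)
    (fun n k l i x hx => ?_) (fun n w e => ?_) (fun n p q hpq w e => ?_) hK
  · rw [Algebra.smul_def]
    simpa using H.mul_mem (H.base_mem (hcoe n p q w e l)) hx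
  · rw [Algebra.smul_def, add_comm]
    have h1 : F.baseD π n k l ∈ TA.deg ((1 : ℕ) : ℤ) := by exact_mod_cast F.baseD_mem H n k l
    simpa using H.mul_mem (H.base_mem h1) hx
  · funext l
    rw [hμ1, Pi.single_apply, Pi.single_apply, apply_ite π, map_one, map_zero]
  · funext l
    have h := congrArg π.toRingHom (congrFun (hμ2 n p q hpq w e) l)
    rw [map_bd_apply] at h
    refine Eq.trans ?_ h
    simp [act_apply, baseD]

end

end BigradedComplex

end

/-! ### Elimination and exactness of the strands -/

namespace BigradedComplex

variable {K A S : Type*} [Field K] [CommRing A] [Algebra K A] [CommRing S] [Algebra K S]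
  [Algebra A S] {TA : GradingProj ℤ K A} {T Y : GradingProj ℤ K S} {𝒮 : ℕ → ℕ → Submodule K S}
  {π : S →ₐ[A] A} {F : BigradedComplex T 𝒮}

/-- Extension by zero from the strand of second degree zero. -/
def ext {n : ℕ} (x : F.W n → S) (e : F.E n) : S := if h : F.b n e = 0 then x ⟨e, h⟩ else 0

theorem ext_coe {n : ℕ} (x : F.W n → S) (w : F.W n) : ext x w = x w := dif_pos w.2

theorem ext_of_ne {n : ℕ} (x : F.W n → S) {e : F.E n} (h : F.b n e ≠ 0) : ext x e = 0 := dif_neg h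

/-- The elements with b = 0 form a subcomplex of F, and their entries lie in A, so the reduced
differential agrees with that of F. -/
theorem act_ext (H : BigradedRetract TA T Y 𝒮 π) {n : ℕ} (x : F.W (n + 1) → S) :
    act (F.D n) (ext x) = ext (act (F.strandD π n) x) := by
  funext l
  by_cases hl : F.b n l = 0
  · rw [show l = (⟨l, hl⟩ : F.W n).1 from rfl, ext_coe, act_apply, act_apply,
      ← sum_W (fun e => F.D n e l • ext x e) fun e he => by rw [ext_of_ne x he, smul_zero]]
    refine Finset.sum_congr rfl fun w _ => ?_
    rw [ext_coe, strandD, baseD_smul H (by rw [w.2, hl]), smul_eq_mul]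
  · rw [ext_of_ne _ hl, act_apply]
    refine Finset.sum_eq_zero fun e _ => ?_
    by_cases he : F.b (n + 1) e = 0
    · rw [F.D_other n e l (by omega) (by omega), zero_smul]
    · rw [ext_of_ne x he, smul_zero]

/-- One step of the elimination of the components of large second degree from a primitive. -/
theorem exists_eliminate (H : BigradedRetract TA T Y 𝒮 π) {i j c n : ℕ} (hc : c + 1 ≤ j)
    (hK : Kos (F.baseD π) fun i => 𝒮 i (j - (c + 1))) {x : F.E n → S}
    (hx : ∀ e, F.b n e ≠ 0 → x e = 0) {y : F.E (n + 1) → S} (hyx : act (F.D n) y = x)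
    (hy : ∀ e, F.b (n + 1) e ≤ c + 1 → y e ∈ 𝒮 (i + F.b (n + 1) e) (j - F.b (n + 1) e))
    (hy0 : ∀ e, c + 1 < F.b (n + 1) e → y e = 0) :
    ∃ y : F.E (n + 1) → S, act (F.D n) y = x ∧
      (∀ e, F.b (n + 1) e ≤ c → y e ∈ 𝒮 (i + F.b (n + 1) e) (j - F.b (n + 1) e)) ∧
      ∀ e, c < F.b (n + 1) e → y e = 0 := by
  let z : F.E (n + 1) → S := fun e => if F.b (n + 1) e = c + 1 then y e else 0
  -- At a target with b = c + 1, only sources with b = c + 1 or c + 2 contribute to the boundary of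
  -- y. The latter components vanish, and x is zero there since c + 1 > 0.
  have hz : act (F.baseD π n) z = 0 := by
    funext l
    rw [act_apply, Pi.zero_apply]
    by_cases hl : F.b n l = c + 1
    · rw [← hx l (by omega), ← hyx, act_apply]
      refine Finset.sum_congr rfl fun e _ => ?_
      by_cases he : F.b (n + 1) e = c + 1
      · rw [baseD_smul H (by omega), smul_eq_mul]
        simp only [z, if_pos he]
      · simp only [z, if_neg he, smul_zero]
        rcases lt_or_gt_of_ne he with h | h
        · rw [F.D_other n e l (by omega) (by omega), zero_smul]
        · rw [hy0 e h, smul_zero]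
    · refine Finset.sum_eq_zero fun e _ => ?_
      by_cases he : F.b (n + 1) e = c + 1
      · rw [baseD_eq_zero H (by omega), zero_smul]
      · simp only [z, if_neg he, smul_zero]
  -- The component has first degree i + c + 1, positive thanks to c + 1 ≥ 1, so exactness in
  -- positive degrees applies.
  obtain ⟨u, hu, huz⟩ := hK (n + 1) (i + c) z (fun e => by
    by_cases he : F.b (n + 1) e = c + 1
    · simp only [z, if_pos he]
      have := hy e he.le
      rwa [he] at this
    · simp only [z, if_neg he]
      exact Submodule.zero_mem _) hz
  let u' : F.E (n + 1 + 1) → S := fun f => if F.b (n + 1 + 1) f = c + 1 then u f else 0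
  have hD (e : F.E (n + 1)) (he : F.b (n + 1) e = c + 1) : act (F.D (n + 1)) u' e = y e := by
    have : y e = z e := by simp only [z, if_pos he]
    rw [this, ← huz, act_apply, act_apply]
    refine Finset.sum_congr rfl fun f _ => ?_
    by_cases hf : F.b (n + 1 + 1) f = c + 1
    · rw [baseD_smul H (by omega), smul_eq_mul]
      simp only [u', if_pos hf]
    · rw [baseD_eq_zero H (by omega), zero_smul]
      simp only [u', if_neg hf, smul_zero]
  -- The boundary of u' equals y at b = c + 1; its only other contribution is at b = c, through
  -- entries of bidegree (0, 1), which preserve the required bidegrees.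
  refine ⟨y - act (F.D (n + 1)) u', ?_, fun e he => ?_, fun e he => ?_⟩
  · rw [map_sub, hyx, act_act]
    simp only [F.D_comp]
    rw [act_zero_matrix, sub_zero]
  · refine Submodule.sub_mem _ (hy e (by omega)) (act_mem e fun f => ?_)
    by_cases hf : F.b (n + 1 + 1) f = c + 1
    · simp only [u', if_pos hf]
      by_cases h : F.b (n + 1) e = c
      · have h1 := H.mul_mem (F.D_succ (n + 1) f e (by omega)) (hu f)
        rw [h]
        rwa [zero_add, show 1 + (j - (c + 1)) = j - c by omega] at h1
      · rw [F.D_other (n + 1) f e (by omega) (by omega), zero_mul]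
        exact Submodule.zero_mem _
    · simp only [u', if_neg hf, mul_zero]
      exact Submodule.zero_mem _
  · rw [Pi.sub_apply]
    by_cases h : F.b (n + 1) e = c + 1
    · rw [hD e h, sub_self]
    · rw [hy0 e (by omega), act_apply, Finset.sum_eq_zero, sub_zero]
      intro f _
      by_cases hf : F.b (n + 1 + 1) f = c + 1
      · rw [F.D_other (n + 1) f e (by omega) (by omega), zero_smul]
      · simp only [u', if_neg hf, smul_zero]

/-- Every component of `S` with respect to the second degree is a Koszul module over `A`. -/
theorem kos_strandD (H : BigradedRetract TA T Y 𝒮 π) (j : ℕ) :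
    Kos (F.strandD π) fun i => 𝒮 i j := by
  induction j using Nat.strong_induction_on with
  | _ j ih =>
  intro n i x hx hc
  have hxT (e : F.E n) : ext x e ∈ T.deg ((i + j + 1 : ℕ) : ℤ) := by
    by_cases he : F.b n e = 0
    · rw [show e = (⟨e, he⟩ : F.W n).1 from rfl, ext_coe, add_right_comm]
      exact H.mem_T (hx _)
    · rw [ext_of_ne x he]
      exact Submodule.zero_mem _
  obtain ⟨y₀, hy₀, hyx₀⟩ := F.exact n (i + j) (ext x) hxT (by
    cases n with
    | zero => exact True.intro
    | succ n =>
      change act (F.D n) _ = 0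
      rw [act_ext H, show act (F.strandD π n) x = 0 from hc]
      funext e
      simp [ext])
  have hext (e : F.E n) : Y.proj ((j : ℤ) - F.b n e) (ext x e) = ext x e := by
    by_cases he : F.b n e = 0
    · rw [show e = (⟨e, he⟩ : F.W n).1 from rfl, ext_coe, he, Nat.cast_zero, sub_zero]
      exact H.mem_Y (hx _)
    · rw [ext_of_ne x he, map_zero]
  -- Projecting to the second degree of x makes the primitive bihomogeneous; its components with b >
  -- j then have negative second degree and vanish.
  let y₁ : F.E (n + 1) → S := fun e => Y.proj ((j : ℤ) - F.b (n + 1) e) (y₀ e)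
  have hy₁ : act (F.D n) y₁ = ext x := by
    rw [act_proj_fine (F.D_mem_Y H n), hyx₀]
    exact funext hext
  have hy₁T (e) : y₁ e ∈ T.deg ((i + j : ℕ) : ℤ) := by
    rw [GradingProj.mem_deg, H.proj_comm, GradingProj.mem_deg.1 (hy₀ e)]
  -- Descent on the largest surviving b, from j to 0. Removing b = c > 0 uses the induction
  -- hypothesis for second degree j - c < j.
  have key (d : ℕ) : d ≤ j → ∃ y : F.E (n + 1) → S, act (F.D n) y = ext x ∧
      (∀ e, F.b (n + 1) e ≤ j - d → y e ∈ 𝒮 (i + F.b (n + 1) e) (j - F.b (n + 1) e)) ∧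
      ∀ e, j - d < F.b (n + 1) e → y e = 0 := by
    induction d with
    | zero =>
      refine fun _ => ⟨y₁, hy₁, fun e he => ?_, fun e he => ?_⟩
      · refine H.mem_of_mem ?_ ?_
        · rw [show i + F.b (n + 1) e + (j - F.b (n + 1) e) = i + j by omega]
          exact hy₁T e
        · rw [Nat.cast_sub (by omega)]
          exact GradingProj.proj_mem _ _
      · exact H.eq_zero_of_mem (hy₁T e) (GradingProj.proj_mem _ _) (Or.inl (by omega))
    | succ d ihd =>
      intro hd
      obtain ⟨y, hyx, hy, hy0⟩ := ihd (by omega)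
      rw [show j - d = j - (d + 1) + 1 by omega] at hy hy0
      exact exists_eliminate H (by omega) (kos_baseD H (ih _ (by omega)))
        (fun e he => ext_of_ne x he) hyx hy hy0
  obtain ⟨y, hyx, hy, hy0⟩ := key j le_rfl
  rw [Nat.sub_self] at hy hy0
  refine ⟨fun w => y w, fun w => ?_, ?_⟩
  · have := hy w w.2.le
    rwa [w.2] at this
  · funext w
    rw [← ext_coe x w, ← hyx, act_apply, act_apply,
      ← sum_W (fun e => F.D n e w • y e) fun e he => by rw [hy0 e (by omega), smul_zero]]
    refine Finset.sum_congr rfl fun w' _ => ?_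
    rw [strandD, baseD_smul H (by rw [w'.2, w.2]), smul_eq_mul]

/-- The strand of second degree zero is a linear resolution of the residue class field of the base
algebra. -/
noncomputable def strand (F : BigradedComplex T 𝒮) (H : BigradedRetract TA T Y 𝒮 π) :
    KoszulComplex TA where
  E := F.W
  fin := inferInstance
  D := F.strandD π
  D_mem n k l := baseD_mem (F := F) H n k l
  D_comp := strandD_comp H
  nonempty := ⟨default⟩
  exact := by
    intro n i x hx hc
    -- Second degree zero of S is the image of A, so the case j = 0 is carried to A and back by
    -- `algebraMap` and π.
    obtain ⟨y, hy, hyx⟩ := kos_strandD (F := F) H 0 n i (fun w => algebraMap A S (x w))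
      (fun w => H.base_mem (hx w)) (by
        cases n with
        | zero => exact True.intro
        | succ n =>
          change act (F.strandD π n) _ = 0
          refine (map_act (Algebra.linearMap A S) (F.strandD π n) x).symm.trans (funext fun w => ?_)
          rw [show act (F.strandD π n) x = 0 from hc]
          exact map_zero _)
    refine ⟨fun w => π (y w), fun w => H.π_mem (hy w), ?_⟩
    have h := map_act π.toLinearMap (F.strandD π n) y
    rw [hyx] at h
    refine h.symm.trans (funext fun w => ?_)
    exact π.commutes (x w)

end BigradedComplex

theorem BigradedRetract.proj_algebraMap {K A S : Type*} [Field K] [CommRing A] [Algebra K A]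
    [CommRing S] [Algebra K S] [Algebra A S] {TA : GradingProj ℤ K A} {T Y : GradingProj ℤ K S}
    {𝒮 : ℕ → ℕ → Submodule K S} {π : S →ₐ[A] A} (H : BigradedRetract TA T Y 𝒮 π)
    (hTA : TA.IsConnected) (k : ℤ) (a : A) :
    T.proj k (algebraMap A S a) = algebraMap A S (TA.proj k a) := by
  obtain ⟨s, hs⟩ := TA.exists_sum a
  rw [← hs]
  simp only [map_sum]
  refine Finset.sum_congr rfl fun l _ => ?_
  rcases lt_or_ge l 0 with hl | hl
  · simp only [hTA.proj_neg l hl, map_zero]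
  · lift l to ℕ using hl
    have h := H.mem_T (H.base_mem (GradingProj.proj_mem (G := TA) (l : ℤ) a))
    rw [add_zero] at h
    by_cases hk : k = l
    · rw [hk, GradingProj.mem_deg.1 h, TA.proj_self]
    · rw [GradingProj.proj_of_mem_ne h hk, TA.proj_ne _ _ _ hk, map_zero]

theorem BigradedRetract.algebraMap_mem_Y {K A S : Type*} [Field K] [CommRing A] [Algebra K A]
    [CommRing S] [Algebra K S] [Algebra A S] {TA : GradingProj ℤ K A} {T Y : GradingProj ℤ K S}
    {𝒮 : ℕ → ℕ → Submodule K S} {π : S →ₐ[A] A} (H : BigradedRetract TA T Y 𝒮 π)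
    (hTA : TA.IsConnected) (a : A) : algebraMap A S a ∈ Y.deg 0 := by
  obtain ⟨s, hs⟩ := TA.exists_sum a
  rw [← hs, map_sum]
  refine Submodule.sum_mem _ fun l _ => ?_
  rcases lt_or_ge l 0 with hl | hl
  · rw [hTA.proj_neg l hl, map_zero]
    exact Submodule.zero_mem _
  · lift l to ℕ using hl
    exact_mod_cast H.mem_Y (H.base_mem (GradingProj.proj_mem (G := TA) (l : ℤ) a))

/-! ### Symmetric powers as the components of fixed second degree -/

section SymPower

variable {K A M : Type*} [Field K] [CommRing A] [Algebra K A] [AddCommGroup M] [Module K M]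
  [Module A M] [IsScalarTower K A M] {𝒜 : ℕ → Submodule K A}
  {ℳ : ℤ → Submodule K M} {e : ℤ}

theorem prod_mem_symPower {j : ℕ} (f : Fin j → M) :
    ∏ l, SymmetricAlgebra.ι A M (f l) ∈ symPower A M j := by
  induction j with
  | zero =>
    rw [symPower, pow_zero]
    exact Submodule.one_le.1 le_rfl
  | succ j ih =>
    rw [Fin.prod_univ_succ, symPower, pow_succ']
    exact Submodule.mul_mem_mul (LinearMap.mem_range_self _ _) (ih _)

theorem symBigrading_le_symPower {i j : ℕ} {s : SymmetricAlgebra A M}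
    (hs : s ∈ symBigrading 𝒜 ℳ e i j) : s ∈ symPower A M j := by
  induction hs using Submodule.span_induction with
  | mem s hs =>
    obtain ⟨r, f, -, -, rfl⟩ := hs
    rw [← Algebra.smul_def]
    exact Submodule.smul_mem _ _ (prod_mem_symPower f)
  | zero => exact Submodule.zero_mem _
  | add x y _ _ hx hy => exact Submodule.add_mem _ hx hy
  | smul c x _ hx =>
    rw [← algebraMap_smul A c x]
    exact Submodule.smul_mem _ _ hx

theorem mem_symPowerGrading {j : ℕ} {x : SymmetricAlgebra A M}
    (hx : x ∈ symBigrading 𝒜 ℳ e 0 j) : ∃ hs : x ∈ symPower A M j,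
      (⟨x, hs⟩ : symPower A M j) ∈ symPowerGrading 𝒜 ℳ j (j * e) := by
  induction hx using Submodule.span_induction with
  | mem s hs =>
    obtain ⟨r, f, hr, hf, rfl⟩ := hs
    exact ⟨symBigrading_le_symPower (Submodule.subset_span ⟨r, f, hr, hf, rfl⟩),
      Submodule.subset_span ⟨0, r, fun _ => e, f, hr, hf, by simp, rfl⟩⟩
  | zero => exact ⟨Submodule.zero_mem _, Submodule.zero_mem _⟩
  | add x y _ _ hx hy =>
    obtain ⟨hx, hx'⟩ := hx
    obtain ⟨hy, hy'⟩ := hy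
    exact ⟨Submodule.add_mem _ hx hy, Submodule.add_mem _ hx' hy'⟩
  | smul c x _ hx =>
    obtain ⟨hx, hx'⟩ := hx
    refine ⟨?_, Submodule.smul_mem _ c hx'⟩
    rw [← algebraMap_smul A c x]
    exact Submodule.smul_mem _ _ hx

variable [GradedAlgebra 𝒜] {T Y : GradingProj ℤ K (SymmetricAlgebra A M)}

theorem symPower_le_deg (H : BigradedRetract (baseGrading 𝒜) T Y (symBigrading 𝒜 ℳ e)
    SymmetricAlgebra.algebraMapInv) (hTA : (baseGrading 𝒜).IsConnected)
    (hgen : Submodule.span A (ℳ e : Set M) = ⊤) {j : ℕ} {s : SymmetricAlgebra A M}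
    (hs : s ∈ symPower A M j) : s ∈ Y.deg (j : ℤ) := by
  have hι (m : M) : SymmetricAlgebra.ι A M m ∈ Y.deg 1 := by
    have hm : m ∈ Submodule.span A (ℳ e : Set M) := hgen ▸ Submodule.mem_top
    induction hm using Submodule.span_induction with
    | mem m hm => exact_mod_cast H.mem_Y (ι_mem_symBigrading hm)
    | zero => rw [map_zero]; exact Submodule.zero_mem _
    | add a b _ _ ha hb => rw [map_add]; exact Submodule.add_mem _ ha hb
    | smul a m _ hm =>
      rw [map_smul, Algebra.smul_def]
      simpa using GradingProj.mul_mem (H.algebraMap_mem_Y hTA a) hm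
  induction hs using Submodule.pow_induction_on_left' with
  | algebraMap r => exact_mod_cast H.algebraMap_mem_Y hTA r
  | add x y i _ _ hx hy => exact Submodule.add_mem _ hx hy
  | mem_mul m hm i x _ hx =>
    obtain ⟨m, rfl⟩ := hm
    rw [Nat.cast_succ, add_comm]
    exact GradingProj.mul_mem (hι m) hx

/-- The pieces of a symmetric power with respect to the first degree. -/
def symPowerPiece (𝒜 : ℕ → Submodule K A) (ℳ : ℤ → Submodule K M) (e : ℤ) (j i : ℕ) :
    Submodule K (symPower A M j) :=
  (symBigrading 𝒜 ℳ e i j).comap ((symPower A M j).subtype.restrictScalars K)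

/-- An element of S^j(M) has second degree j, so each of its total-degree components lies in a
single bigraded piece, which is contained in S^j(M). -/
theorem symPowerPiece_iSup (H : BigradedRetract (baseGrading 𝒜) T Y (symBigrading 𝒜 ℳ e)
    SymmetricAlgebra.algebraMapInv) (hTA : (baseGrading 𝒜).IsConnected)
    (hgen : Submodule.span A (ℳ e : Set M) = ⊤) (j : ℕ) :
    ⨆ i, symPowerPiece 𝒜 ℳ e j i = ⊤ := by
  rw [eq_top_iff]
  rintro ⟨x, hx⟩ -
  have hY := symPower_le_deg H hTA hgen hx
  obtain ⟨s, hs⟩ := T.exists_sum x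
  have hmem (k : ℤ) : ∃ h : T.proj k x ∈ symPower A M j,
      (⟨T.proj k x, h⟩ : symPower A M j) ∈ ⨆ i, symPowerPiece 𝒜 ℳ e j i := by
    have h1 : T.proj k x = Y.proj j (T.proj k x) := by
      rw [← H.proj_comm, GradingProj.mem_deg.1 hY]
    rcases lt_or_ge k j with hk | hk
    · have h0 : T.proj k x = 0 := by rw [h1, H.proj_proj_eq_zero (Or.inr hk)]
      simp only [h0]
      exact ⟨Submodule.zero_mem _, Submodule.zero_mem _⟩
    · obtain ⟨i, rfl⟩ : ∃ i : ℕ, k = (i + j : ℕ) := ⟨(k - j).toNat, by omega⟩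
      have h2 := H.proj_proj_mem i j x
      rw [← h1] at h2
      exact ⟨symBigrading_le_symPower h2, Submodule.mem_iSup_of_mem i h2⟩
  choose h1 h2 using hmem
  have : (⟨x, hx⟩ : symPower A M j) = ∑ k ∈ s, ⟨T.proj k x, h1 k⟩ := by
    apply Subtype.ext
    rw [AddSubmonoidClass.coe_finsetSum]
    exact hs.symm
  rw [this]
  exact Submodule.sum_mem _ fun k _ => h2 k

/-- The projections of a symmetric power with respect to the first degree. -/
noncomputable def symPowerProj (H : BigradedRetract (baseGrading 𝒜) T Y (symBigrading 𝒜 ℳ e)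
    SymmetricAlgebra.algebraMapInv) (j : ℕ) (k : ℤ) : symPower A M j →+ symPower A M j where
  toFun x := ⟨Y.proj j (T.proj (k + j) x), by
    rcases lt_or_ge k 0 with hk | hk
    · rw [H.proj_proj_eq_zero (Or.inr (by omega))]
      exact Submodule.zero_mem _
    · lift k to ℕ using hk
      have := H.proj_proj_mem k j x
      rw [Nat.cast_add] at this
      exact symBigrading_le_symPower this⟩
  map_zero' := Subtype.ext (by simp)
  map_add' x y := Subtype.ext (by simp)

end SymPower

end KoszulSym

/-! ### Koszulness of A and linearity of the symmetric powers -/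

theorem corollary3p1 {K : Type*} [Field K] {A : Type*} [CommRing A] [Algebra K A]
    (𝒜 : ℕ → Submodule K A) [GradedAlgebra 𝒜] (hA : KoszulSym.IsStandardGraded 𝒜)
    {M : Type*} [AddCommGroup M] [Module K M] [Module A M] [IsScalarTower K A M]
    [Module.Finite A M] (ℳ : ℤ → Submodule K M) (hM : KoszulSym.IsGradedModule 𝒜 ℳ)
    (e : ℤ) (hgen : Submodule.span A (ℳ e : Set M) = ⊤)
    (hS : KoszulSym.IsKoszul (KoszulSym.symTotalGrading 𝒜 ℳ e)) :
    KoszulSym.IsKoszul 𝒜 ∧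
      ∀ j : ℕ, KoszulSym.HasLinearResolution 𝒜 (KoszulSym.symPowerGrading 𝒜 ℳ j) (j * e) := by
  open KoszulSym in
  -- The zero ring is treated apart: there the residue ring vanishes, and extracting a complex with
  -- F₀ ≠ 0 needs a nonzero ring.
  rcases subsingleton_or_nontrivial A with hsub | hnon
  · have h1 : Subsingleton (A ⧸ irrelevantIdeal 𝒜) := Module.subsingleton A _
    have h2 (j : ℕ) : Subsingleton (symPower A M j) := Module.subsingleton A _
    exact ⟨hasLinearResolution_of_subsingleton _ _ _,
      fun j => hasLinearResolution_of_subsingleton _ _ _⟩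
  obtain ⟨T, Y, H⟩ := exists_bigradedRetract hM hgen
  have hTA := baseGrading_connected 𝒜 hA.degree_zero
  have hT := H.isConnected hTA
  have h𝒯 (m : ℕ) : symTotalGrading 𝒜 ℳ e m = T.deg (m : ℤ) := (H.deg_eq m).symm
  obtain ⟨C⟩ := hS.nonempty_koszulComplex hT h𝒯
  obtain ⟨F⟩ := H.exists_bigradedComplex hT C h𝒯
  have h𝒜 : (baseGrading 𝒜).deg 1 ≤ 𝒜 1 := by
    rw [baseGrading_deg 𝒜 1]
    exact le_rfl
  refine ⟨?_, fun j => ?_⟩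
  · refine hasLinearResolution_of_stage hTA (fun _ _ _ => rfl)
      (residueStage (F.strand H) (GradingProj.trivial K A) hTA (fun _ _ _ => rfl)
        (baseGrading_deg 𝒜)) h𝒜
      ((irrelevantIdeal 𝒜).mkQ.comp (LinearMap.proj (0 : Fin 1))) ?_ rfl fun k => ?_
    · exact (Submodule.mkQ_surjective _).comp fun a => ⟨fun _ => a, rfl⟩
    · rw [residueGrading, if_pos rfl]
      exact Submodule.mem_top
  -- The lowest piece sits in total degree j of S, which is finite dimensional because S has a
  -- Koszul complex.
  · have hfin : FiniteDimensional K (symPowerPiece 𝒜 ℳ e j 0) := by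
      have := C.finite_deg hT j
      let f : symPowerPiece 𝒜 ℳ e j 0 →ₗ[K] T.deg (j : ℤ) :=
        { toFun := fun x => ⟨x.1.1, by simpa using H.mem_T x.2⟩
          map_add' := fun _ _ => rfl
          map_smul' := fun _ _ => rfl }
      refine FiniteDimensional.of_injective f fun x y h => Subtype.ext (Subtype.ext ?_)
      exact congrArg (fun z : T.deg (j : ℤ) => z.1) h
    refine hasLinearResolution_of_kos (F.strand H) hTA h𝒜 (𝒩 := symPowerPiece 𝒜 ℳ e j)
      (fun n i x hx hc => ?_) (symPowerPiece_iSup H hTA hgen j) (symPowerProj H j)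
      (fun k b m hm => ?_) (fun i b m hm hb => ?_) fun x hx =>
        (mem_symPowerGrading hx).choose_spec
    -- The exactness proved inside S restricts to S^j(M), because the bigraded pieces containing x
    -- and y lie in it.
    · obtain ⟨y, hy, hyx⟩ := BigradedComplex.kos_strandD (F := F) H j n i (fun w => (x w).1) hx (by
        cases n with
        | zero => exact True.intro
        | succ n =>
          have hc : act (F.strandD _ n) x = 0 := hc
          refine (map_act (symPower A M j).subtype (F.strandD _ n) x).symm.trans
            (funext fun w => ?_)
          rw [hc]
          rfl)
      refine ⟨fun w => ⟨y w, symBigrading_le_symPower (hy w)⟩, hy, ?_⟩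
      funext w
      apply Subtype.ext
      rw [← congrFun hyx w]
      exact congrFun (map_act (symPower A M j).subtype (F.strandD _ n)
        fun w => ⟨y w, symBigrading_le_symPower (hy w)⟩) w
    · apply Subtype.ext
      change Y.proj j (T.proj (k + j) (b • m.1)) = (baseGrading 𝒜).proj k b • m.1
      have hmT : m.1 ∈ T.deg ((0 + j : ℕ) : ℤ) := H.mem_T hm
      rw [zero_add] at hmT
      rw [Algebra.smul_def, GradingProj.proj_mul_of_mem hmT, add_sub_cancel_right,
        H.proj_algebraMap hTA, Algebra.smul_def]
      have := GradingProj.mul_mem (H.algebraMap_mem_Y hTA ((baseGrading 𝒜).proj k b)) (H.mem_Y hm)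
      rwa [zero_add] at this
    · change b • m.1 ∈ symBigrading 𝒜 ℳ e i j
      rw [Algebra.smul_def]
      simpa using H.mul_mem (H.base_mem hb) hm
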